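/- Let $n, d \ge 0$ be integers. (1) Let $k$ be a field and let $A_0 \subseteq \mathrm{M}_n(k)$ be a (unital) $k$-subalgebra. Put $N(A_0) = \{X \in \mathrm{M}_n(k) \mid Xa - aX \in A_0 \text{ for all } a \in A_0\}$, let $\mathrm{Der}_k(A_0, \mathrm{M}_n(k)/A_0)$ be the space of $k$-linear maps $f : A_0 \to \mathrm{M}_n(k)/A_0$ with $f(ab) = a f(b) + f(a) b$, and let $H^1(A_0, \mathrm{M}_n(k)/A_0)$ be the first Hochschild cohomology of $A_0$ with coefficients in the bimodule $\mathrm{M}_n(k)/A_0$. Then the sequence of $k$-linear maps \[ 0 \to N(A_0)/A_0 \to \mathrm{M}_n(k)/A_0 \xrightarrow{\ \bar d\ } \mathrm{Der}_k(A_0, \mathrm{M}_n(k)/A_0) \to H^1(A_0, \mathrm{M}_n(k)/A_0) \to 0 \] is exact, where the first map is induced by the inclusion $N(A_0) \subseteq \mathrm{M}_n(k)$, $\bar d(X)(a) = (Xa - aX \bmod A_0)$, and the last map sends a derivation to the class of the Hochschild $1$-cocycle that it is. (2) A rank $d$ mold of degree $n$ on a scheme $X$ is a subsheaf of $\mathcal{O}_X$-algebras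 $\mathcal{A} \subseteq \mathrm{M}_n(\mathcal{O}_X)$ such that $\mathcal{A}$ and $\mathrm{M}_n(\mathcal{O}_X)/\mathcal{A}$ are locally free and $\mathcal{A}$ has rank $d$. Let $\mathrm{Mold}_{n,d}$ be the scheme that represents the functor sending a scheme $X$ to the set of rank $d$ molds of degree $n$ on $X$, and let $\mathcal{A}$ be the universal mold on it. For a point $x \in \mathrm{Mold}_{n,d}$ with residue field $k(x)$, let $\mathcal{A}(x) = \mathcal{A} \otimes k(x) \subseteq \mathrm{M}_n(k(x))$ be the corresponding subalgebra, and let $T_{\mathrm{Mold}_{n,d}/\mathbb{Z}, x}$ be the tangent space, i.e. the $k(x)$-vector space of morphisms $\mathrm{Spec}\, k(x)[\epsilon]/(\epsilon^2) \to \mathrm{Mold}_{n,d}$ that extend the canonical morphism $\mathrm{Spec}\, k(x) \to \mathrm{Mold}_{n,d}$. Then, for every point $x$ of $\mathrm{Mold}_{n,d}$, the spaces $T_{\mathrm{Mold}_{n,d}/\mathbb{Z}, x}$ and $H^1(\mathcal{A}(x), \mathrm{M}_n(k(x))/\mathcal{A}(x))$ are finite-dimensional over $k(x)$, and \[ \dim_{k(x)}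 T_{\mathrm{Mold}_{n,d}/\mathbb{Z}, x} = \dim_{k(x)} H^1(\mathcal{A}(x), \mathrm{M}_n(k(x))/\mathcal{A}(x)) + n^2 - \dim_{k(x)} N(\mathcal{A}(x)). \] -/

import Mathlib

open CategoryTheory AlgebraicGeometry TopologicalSpace Opposite

section Hochschild

variable (k : Type*) [CommRing k] (A : Type*) [Ring A] [Algebra k A]
  (M : Type*) [AddCommGroup M] [Module k M] [Module A M] [Module Aᵐᵒᵖ M]
  [SMulCommClass A Aᵐᵒᵖ M] [IsScalarTower k A M] [IsScalarTower k Aᵐᵒᵖ M]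

/-- The coboundary `C⁰(A, M) = M → C¹(A, M) = Hom_k(A, M)`, `m ↦ (a ↦ a m - m a)`. -/
def hochschildD0 : M →ₗ[k] (A →ₗ[k] M) :=
  LinearMap.mk₂ k (fun m a => a • m - MulOpposite.op a • m)
    (fun m m' a => by simp only [smul_add]; abel)
    (fun c m a => by
      rw [smul_sub, smul_comm a c m, smul_comm (MulOpposite.op a) c m])
    (fun m a a' => by simp only [add_smul, MulOpposite.op_add]; abel)
    (fun c m a => by rw [MulOpposite.op_smul, smul_assoc, smul_assoc, smul_sub])

/-- The coboundary `C¹(A, M) → C²(A, M) = Hom_k(A ⊗ A, M)`,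
`f ↦ (a ⊗ b ↦ a f(b) - f(ab) + f(a) b)`. -/
def hochschildD1 : (A →ₗ[k] M) →ₗ[k] (A →ₗ[k] A →ₗ[k] M) where
  toFun f := LinearMap.mk₂ k (fun a b => a • f b - f (a * b) + MulOpposite.op b • f a)
    (fun a a' b => by simp only [add_smul, add_mul, map_add, smul_add]; abel)
    (fun c a b => by
      rw [smul_assoc, smul_mul_assoc, map_smul, map_smul, smul_add, smul_sub,
        smul_comm (MulOpposite.op b) c])
    (fun a b b' => by
      simp only [add_smul, mul_add, map_add, smul_add, MulOpposite.op_add]; abel)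
    (fun c a b => by
      rw [MulOpposite.op_smul, smul_assoc, mul_smul_comm, map_smul, map_smul, smul_add, smul_sub,
        smul_comm a c])
  map_add' f g := by
    ext a b
    simp only [LinearMap.mk₂_apply, LinearMap.add_apply, smul_add]; abel
  map_smul' c f := by
    ext a b
    simp only [LinearMap.mk₂_apply, LinearMap.smul_apply, smul_add, smul_sub, RingHom.id_apply,
      smul_comm a c, smul_comm (MulOpposite.op b) c]

/-- The first Hochschild cohomology `H¹(A, M) = ker d¹ / im d⁰` of the algebra `A` with
coefficients in the bimodule `M`. -/
abbrev HochschildH1 : Type _ :=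
  (LinearMap.ker (hochschildD1 k A M)) ⧸
    (LinearMap.range (hochschildD0 k A M)).submoduleOf (LinearMap.ker (hochschildD1 k A M))

/-- The consecutive coboundaries compose to zero, so that `im d⁰ ⊆ ker d¹`. -/
theorem range_hochschildD0_le :
    LinearMap.range (hochschildD0 k A M) ≤ LinearMap.ker (hochschildD1 k A M) := by
  rintro _ ⟨m, rfl⟩
  rw [LinearMap.mem_ker]
  ext a b
  simp only [hochschildD1, hochschildD0, LinearMap.coe_mk, AddHom.coe_mk, LinearMap.mk₂_apply,
    LinearMap.zero_apply, smul_sub, mul_smul, MulOpposite.op_mul,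
    ← smul_comm a (MulOpposite.op b) m]
  abel

/-- The `k`-linear derivations `f(ab) = a f(b) + f(a) b` of `A` with values in the bimodule `M`. -/
def derivations : Submodule k (A →ₗ[k] M) where
  carrier := {f | ∀ a b : A, f (a * b) = a • f b + MulOpposite.op b • f a}
  add_mem' {f g} hf hg a b := by
    simp only [LinearMap.add_apply, hf a b, hg a b, smul_add]; abel
  zero_mem' a b := by simp
  smul_mem' c f hf a b := by
    simp only [LinearMap.smul_apply, hf a b, smul_add, smul_comm a c,
      smul_comm (MulOpposite.op b) c]

/-- The map `Der_k(A, M) → H¹(A, M)` sending a derivation to the class of the 1-cocycle it is. -/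
def derivationsToH1 : derivations k A M →ₗ[k] HochschildH1 k A M :=
  (Submodule.mkQ _).comp
    (LinearMap.codRestrict (LinearMap.ker (hochschildD1 k A M)) (derivations k A M).subtype
      (fun f => by
        rw [LinearMap.mem_ker]
        ext a b
        simp only [hochschildD1, LinearMap.coe_mk, AddHom.coe_mk, LinearMap.mk₂_apply,
          LinearMap.zero_apply, Submodule.subtype_apply, f.2 a b]
        abel))

end Hochschild

section Matrices

variable {k : Type*} [Field k] {n : ℕ} (A : Subalgebra k (Matrix (Fin n) (Fin n) k))

/-- The `k`-vector space `M_n(k)/A`. -/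
abbrev MatQuot : Type _ := Matrix (Fin n) (Fin n) k ⧸ Subalgebra.toSubmodule A

/-- The left action `a [X] = [aX]` of `A` on `M_n(k)/A`. -/
instance MatQuot.leftModule : Module A (MatQuot A) where
  smul a := Submodule.mapQ _ _ (LinearMap.mulLeft k (a : Matrix (Fin n) (Fin n) k))
    (fun _ hx => A.mul_mem a.2 hx)
  one_smul := by
    rintro ⟨x⟩; exact congrArg (Submodule.Quotient.mk (p := Subalgebra.toSubmodule A)) (one_mul x)
  mul_smul := by
    rintro a b ⟨x⟩
    exact congrArg (Submodule.Quotient.mk (p := Subalgebra.toSubmodule A)) (mul_assoc _ _ x)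
  smul_zero a := map_zero (Submodule.mapQ _ _ (LinearMap.mulLeft k (a : Matrix (Fin n) (Fin n) k)) _)
  smul_add a := map_add (Submodule.mapQ _ _ (LinearMap.mulLeft k (a : Matrix (Fin n) (Fin n) k)) _)
  add_smul := by
    rintro a b ⟨x⟩
    exact congrArg (Submodule.Quotient.mk (p := Subalgebra.toSubmodule A)) (add_mul _ _ x)
  zero_smul := by
    rintro ⟨x⟩
    exact congrArg (Submodule.Quotient.mk (p := Subalgebra.toSubmodule A)) (zero_mul x)

/-- The right action `[X] a = [Xa]` of `A` on `M_n(k)/A`. -/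
instance MatQuot.rightModule : Module Aᵐᵒᵖ (MatQuot A) where
  smul a := Submodule.mapQ _ _ (LinearMap.mulRight k (a.unop : Matrix (Fin n) (Fin n) k))
    (fun _ hx => A.mul_mem hx a.unop.2)
  one_smul := by
    rintro ⟨x⟩; exact congrArg (Submodule.Quotient.mk (p := Subalgebra.toSubmodule A)) (mul_one x)
  mul_smul := by
    rintro a b ⟨x⟩
    exact congrArg (Submodule.Quotient.mk (p := Subalgebra.toSubmodule A)) (mul_assoc x _ _).symm
  smul_zero a := map_zero
    (Submodule.mapQ _ _ (LinearMap.mulRight k (a.unop : Matrix (Fin n) (Fin n) k)) _)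
  smul_add a := map_add
    (Submodule.mapQ _ _ (LinearMap.mulRight k (a.unop : Matrix (Fin n) (Fin n) k)) _)
  add_smul := by
    rintro a b ⟨x⟩
    exact congrArg (Submodule.Quotient.mk (p := Subalgebra.toSubmodule A)) (mul_add x _ _)
  zero_smul := by
    rintro ⟨x⟩
    exact congrArg (Submodule.Quotient.mk (p := Subalgebra.toSubmodule A)) (mul_zero x)

instance : SMulCommClass A Aᵐᵒᵖ (MatQuot A) where
  smul_comm := by
    rintro a b ⟨x⟩
    exact congrArg (Submodule.Quotient.mk (p := Subalgebra.toSubmodule A)) (mul_assoc _ x _).symm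

instance : IsScalarTower k A (MatQuot A) where
  smul_assoc := by
    rintro c a ⟨x⟩
    exact congrArg (Submodule.Quotient.mk (p := Subalgebra.toSubmodule A))
      (smul_mul_assoc c (a : Matrix (Fin n) (Fin n) k) x)

instance : IsScalarTower k Aᵐᵒᵖ (MatQuot A) where
  smul_assoc := by
    rintro c a ⟨x⟩
    exact congrArg (Submodule.Quotient.mk (p := Subalgebra.toSubmodule A))
      (mul_smul_comm c x (a.unop : Matrix (Fin n) (Fin n) k))

/-- The normalizer `N(A) = {X ∈ M_n(k) | Xa - aX ∈ A for all a ∈ A}`. -/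
def matNormalizer : Submodule k (Matrix (Fin n) (Fin n) k) where
  carrier := {X | ∀ a ∈ A, X * a - a * X ∈ A}
  add_mem' {X Y} hX hY a ha := by
    have := A.add_mem (hX a ha) (hY a ha)
    rwa [show (X + Y) * a - a * (X + Y) = X * a - a * X + (Y * a - a * Y) by noncomm_ring]
  zero_mem' a ha := by simp
  smul_mem' c X hX a ha := by
    have := A.smul_mem (hX a ha) c
    rwa [smul_mul_assoc, mul_smul_comm, ← smul_sub]

/-- The space `N(A)/A`. -/
abbrev NormalizerQuot : Type _ :=
  matNormalizer A ⧸ (Subalgebra.toSubmodule A).submoduleOf (matNormalizer A)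

/-- The map `N(A)/A → M_n(k)/A` induced by the inclusion `N(A) ⊆ M_n(k)`. -/
def normalizerQuotToMatQuot : NormalizerQuot A →ₗ[k] MatQuot A :=
  Submodule.mapQ _ _ (matNormalizer A).subtype le_rfl

/-- The map `d : M_n(k) → Der_k(A, M_n(k)/A)`, `d(X)(a) = [X, a] mod A`. -/
def matToDer : Matrix (Fin n) (Fin n) k →ₗ[k] derivations k A (MatQuot A) where
  toFun X :=
    ⟨(Submodule.mkQ (Subalgebra.toSubmodule A)).comp
      ((LinearMap.mulLeft k X - LinearMap.mulRight k X).comp A.val.toLinearMap), by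
      intro a b
      refine congrArg (Submodule.Quotient.mk (p := Subalgebra.toSubmodule A))
        (?_ : X * ((a : Matrix (Fin n) (Fin n) k) * b) - (a : Matrix (Fin n) (Fin n) k) * b * X =
          (a : Matrix (Fin n) (Fin n) k) * (X * b - b * X) + (X * a - a * X) * b)
      noncomm_ring⟩
  map_add' X Y := by
    ext a
    refine congrArg (Submodule.Quotient.mk (p := Subalgebra.toSubmodule A))
      (?_ : (X + Y) * (a : Matrix (Fin n) (Fin n) k) - a * (X + Y) =
        (X * a - a * X) + (Y * a - a * Y))
    noncomm_ring
  map_smul' c X := by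
    ext a
    refine congrArg (Submodule.Quotient.mk (p := Subalgebra.toSubmodule A))
      (?_ : (c • X) * (a : Matrix (Fin n) (Fin n) k) - a * (c • X) = c • (X * a - a * X))
    rw [smul_mul_assoc, mul_smul_comm, smul_sub]

theorem toSubmodule_le_ker_matToDer :
    Subalgebra.toSubmodule A ≤ LinearMap.ker (matToDer A) := by
  intro X hX
  refine LinearMap.mem_ker.2 (Subtype.ext (LinearMap.ext fun a => ?_))
  exact (Submodule.Quotient.mk_eq_zero (Subalgebra.toSubmodule A)).2
    (A.sub_mem (A.mul_mem hX a.2) (A.mul_mem a.2 hX))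

/-- The map `M_n(k)/A → Der_k(A, M_n(k)/A)` induced by `d`. -/
def matQuotToDer : MatQuot A →ₗ[k] derivations k A (MatQuot A) :=
  Submodule.liftQ (R₂ := k) (M₂ := derivations k A (MatQuot A)) (τ₁₂ := RingHom.id k)
    (Subalgebra.toSubmodule A) (matToDer A) (toSubmodule_le_ker_matToDer A)

end Matrices

noncomputable section Tangent

/-- A tangent vector at `x` of a scheme `X` over `ℤ`: a morphism `Spec k(x)[ε] ⟶ X` whose
restriction to `Spec k(x)` is the canonical morphism. (As `Spec ℤ` is terminal, every morphism
of schemes is a morphism over `ℤ`.) -/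
@[ext]
structure TangentVector (X : Scheme.{0}) (x : X) where
  hom : Spec (.of (DualNumber (X.residueField x))) ⟶ X
  restrict : Spec.map (CommRingCat.ofHom
      (TrivSqZeroExt.fstHom (X.residueField x) (X.residueField x) (X.residueField x)).toRingHom) ≫
    hom = X.fromSpecResidueField x

/-- For a homomorphism `r : S → K` to a field: the additive maps `D : S → K` with
`D(ab) = r(a) D(b) + r(b) D(a)`. -/
def pointDerivations {S K : Type*} [CommRing S] [Field K] (r : S →+* K) : Submodule K (S → K) where
  carrier := {D | (∀ a b, D (a + b) = D a + D b) ∧ ∀ a b, D (a * b) = r a * D b + r b * D a}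
  add_mem' {D E} hD hE := ⟨fun a b => by simp only [Pi.add_apply, hD.1, hE.1]; ring,
    fun a b => by simp only [Pi.add_apply, hD.2, hE.2]; ring⟩
  zero_mem' := by simp
  smul_mem' c D hD := ⟨fun a b => by simp only [Pi.smul_apply, hD.1, smul_add],
    fun a b => by simp only [Pi.smul_apply, hD.2, smul_eq_mul]; ring⟩

/-- The homomorphism `S → K[ε]`, `a ↦ r(a) + D(a) ε`. -/
def derivationHom {S K : Type*} [CommRing S] [Field K] (r : S →+* K) (D : pointDerivations r) :
    S →+* DualNumber K where
  toFun a := TrivSqZeroExt.inl (r a) + TrivSqZeroExt.inr (D.1 a)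
  map_one' := by
    have h := D.2.2 1 1
    have h1 : D.1 1 = 0 := by simpa using h
    ext <;> simp [h1]
  map_mul' a b := by
    ext
    · simp
    · simp [D.2.2 a b, mul_comm]
  map_zero' := by
    have h := D.2.1 0 0
    have h1 : D.1 0 = 0 := by simpa using h
    ext <;> simp [h1]
  map_add' a b := by
    ext
    · simp
    · simp [D.2.1 a b]

theorem fst_comp_derivationHom {S K : Type*} [CommRing S] [Field K] (r : S →+* K)
    (D : pointDerivations r) : (TrivSqZeroExt.fstHom K K K).toRingHom.comp (derivationHom r D) = r := by
  ext a
  simp [derivationHom]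

theorem derivationHom_injective {S K : Type*} [CommRing S] [Field K] (r : S →+* K) :
    Function.Injective (derivationHom r) := by
  intro D E h
  ext a
  simpa [derivationHom] using congrArg (fun g => TrivSqZeroExt.snd (g a)) h

theorem exists_derivationHom_eq {S K : Type*} [CommRing S] [Field K] (r : S →+* K)
    (g : S →+* DualNumber K) (h : (TrivSqZeroExt.fstHom K K K).toRingHom.comp g = r) :
    ∃ D, derivationHom r D = g := by
  have h' (a) : TrivSqZeroExt.fst (g a) = r a := congrArg (fun f => f a) h
  refine ⟨⟨fun a => TrivSqZeroExt.snd (g a), fun a b => by simp, fun a b => ?_⟩, ?_⟩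
  · simp [h', mul_comm]
  · ext a
    · simp [derivationHom, h']
    · simp [derivationHom]

variable {X : Scheme.{0}} {x : X}

/-- The tangent vector given by a derivation `D : O_{X,x} → k(x)`: the morphism
`Spec k(x)[ε] ⟶ Spec O_{X,x} ⟶ X` induced by `a ↦ a(x) + D(a) ε`. -/
def derivationTangentVector (D : pointDerivations (X.residue x).hom) : TangentVector X x where
  hom := Spec.map (CommRingCat.ofHom (derivationHom (X.residue x).hom D)) ≫ X.fromSpecStalk x
  restrict := by
    rw [← Spec.map_comp_assoc, ← CommRingCat.ofHom_comp, fst_comp_derivationHom]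
    rfl

theorem exists_eq_SpecMap_fromSpecStalk {R : CommRingCat.{0}} [IsLocalRing R] (f : Spec R ⟶ X)
    (h : f (IsLocalRing.closedPoint R) = x) :
    ∃ φ : X.presheaf.stalk x ⟶ R, f = Spec.map φ ≫ X.fromSpecStalk x := by
  subst h
  exact ⟨_, (Scheme.Spec_stalkClosedPointTo_fromSpecStalk f).symm⟩

theorem apply_closedPoint_of_comp_eq {R S : CommRingCat.{0}} [IsLocalRing R] [IsLocalRing S]
    (φ : R ⟶ S) [IsLocalHom φ.hom] (f : Spec R ⟶ X) (g : Spec S ⟶ X) (h : Spec.map φ ≫ f = g) :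
    f (IsLocalRing.closedPoint R) = g (IsLocalRing.closedPoint S) := by
  subst h
  exact ((Scheme.Hom.comp_apply _ _ _).trans (congrArg f Spec_closedPoint)).symm

theorem derivationTangentVector_bijective :
    Function.Bijective (derivationTangentVector (X := X) (x := x)) := by
  constructor
  · intro D E h
    have h1 := congrArg TangentVector.hom h
    simp only [derivationTangentVector] at h1
    rw [cancel_mono, Spec.map_inj] at h1
    exact derivationHom_injective _ (congrArg CommRingCat.Hom.hom h1)
  · intro v
    have hl : IsLocalHom (TrivSqZeroExt.fstHom (X.residueField x)
        (X.residueField x) (X.residueField x)).toRingHom :=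
      ⟨fun a ha => TrivSqZeroExt.isUnit_iff_isUnit_fst.2 ha⟩
    have hx := apply_closedPoint_of_comp_eq (R := .of (DualNumber (X.residueField x)))
      (CommRingCat.ofHom _) v.hom _ v.restrict
    obtain ⟨φ, hφ⟩ := exists_eq_SpecMap_fromSpecStalk v.hom
      (hx.trans (X.fromSpecResidueField_apply x _))
    have h1 := v.restrict
    rw [hφ, ← Spec.map_comp_assoc, Scheme.fromSpecResidueField, cancel_mono, Spec.map_inj] at h1
    obtain ⟨D, hD⟩ := exists_derivationHom_eq (X.residue x).hom φ.hom
      (congrArg CommRingCat.Hom.hom h1)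
    refine ⟨D, TangentVector.ext ?_⟩
    rw [hφ]
    change Spec.map (CommRingCat.ofHom (derivationHom _ D)) ≫ _ = _
    rw [hD, CommRingCat.ofHom_hom]

/-- Tangent vectors at `x` correspond to the derivations of `O_{X,x}` with values in `k(x)`. -/
def tangentVectorEquiv : TangentVector X x ≃ pointDerivations (X.residue x).hom :=
  (Equiv.ofBijective _ derivationTangentVector_bijective).symm

/-- The canonical `k(x)`-vector space structure on the tangent space: for tangent vectors with
`ψ^♯(a) = a(x) + D(a) ε` the operations are those on the derivations `D`. -/
instance : AddCommGroup (TangentVector X x) := tangentVectorEquiv.addCommGroup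

instance : Module (X.residueField x) (TangentVector X x) := tangentVectorEquiv.module _

end Tangent

noncomputable section BaseChange

variable {n d : ℕ} {R S T : Type*} [CommRing R] [CommRing S] [CommRing T]

/-- For a homomorphism `φ : R → S` and a subalgebra `A ⊆ M_n(R)`, the `S`-subalgebra of `M_n(S)`
generated by the image of `A`. It is the image of `A ⊗_R S → M_n(R) ⊗_R S = M_n(S)`. -/
def matExtend (φ : R →+* S) (A : Subalgebra R (Matrix (Fin n) (Fin n) R)) :
    Subalgebra S (Matrix (Fin n) (Fin n) S) :=
  Algebra.adjoin S (φ.mapMatrix '' (A : Set (Matrix (Fin n) (Fin n) R)))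

theorem mapMatrix_smul (φ : R →+* S) (r : R) (M : Matrix (Fin n) (Fin n) R) :
    φ.mapMatrix (r • M) = φ r • φ.mapMatrix M := by
  ext i j
  simp

theorem mapMatrix_algebraMap (φ : R →+* S) (r : R) :
    φ.mapMatrix (algebraMap R (Matrix (Fin n) (Fin n) R) r) =
      algebraMap S (Matrix (Fin n) (Fin n) S) (φ r) := by
  rw [Algebra.algebraMap_eq_smul_one, Algebra.algebraMap_eq_smul_one, mapMatrix_smul, map_one]

theorem mapMatrix_mem_matExtend (φ : R →+* S) {A : Subalgebra R (Matrix (Fin n) (Fin n) R)}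
    {M : Matrix (Fin n) (Fin n) R} (h : M ∈ A) : φ.mapMatrix M ∈ matExtend φ A :=
  Algebra.subset_adjoin ⟨M, h, rfl⟩

theorem matExtend_le (φ : R →+* S) {A : Subalgebra R (Matrix (Fin n) (Fin n) R)}
    {B : Subalgebra S (Matrix (Fin n) (Fin n) S)} (h : ∀ M ∈ A, φ.mapMatrix M ∈ B) :
    matExtend φ A ≤ B :=
  Algebra.adjoin_le (by rintro _ ⟨M, hM, rfl⟩; exact h M hM)

theorem matExtend_matExtend (φ : R →+* S) (ψ : S →+* T)
    (A : Subalgebra R (Matrix (Fin n) (Fin n) R)) :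
    matExtend ψ (matExtend φ A) = matExtend (ψ.comp φ) A := by
  apply le_antisymm
  · refine matExtend_le ψ fun M hM => ?_
    induction hM using Algebra.adjoin_induction with
    | mem x hx =>
      obtain ⟨y, hy, rfl⟩ := hx
      exact mapMatrix_mem_matExtend (ψ.comp φ) hy
    | algebraMap r => rw [mapMatrix_algebraMap]; exact Subalgebra.algebraMap_mem _ _
    | add x y _ _ hx hy => rw [map_add]; exact add_mem hx hy
    | mul x y _ _ hx hy => rw [map_mul]; exact mul_mem hx hy
  · refine matExtend_le _ fun M hM => ?_
    exact mapMatrix_mem_matExtend ψ (mapMatrix_mem_matExtend φ hM)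

theorem matExtend_id (A : Subalgebra R (Matrix (Fin n) (Fin n) R)) :
    matExtend (RingHom.id R) A = A := by
  apply le_antisymm
  · exact matExtend_le _ fun M hM => by simpa using hM
  · intro M hM
    simpa using mapMatrix_mem_matExtend (RingHom.id R) hM

theorem mem_of_matExtend_bijective (φ : R →+* S) (hφ : Function.Bijective φ)
    {A : Subalgebra R (Matrix (Fin n) (Fin n) R)} {M : Matrix (Fin n) (Fin n) R}
    (h : φ.mapMatrix M ∈ matExtend φ A) : M ∈ A := by
  let e := RingEquiv.ofBijective φ hφ
  have h1 := mapMatrix_mem_matExtend (e.symm : S →+* R) h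
  rw [matExtend_matExtend] at h1
  have h2 : (e.symm : S →+* R).comp φ = RingHom.id R := by
    ext r; exact e.symm_apply_apply r
  rw [h2, matExtend_id] at h1
  convert h1
  ext i j
  exact (e.symm_apply_apply (M i j)).symm

/-! Subalgebras in normal form: for `c : Fin d → Fin n × Fin n` and `f : Fin d → M_n(R)` whose
entries at the positions `c l` are `δ_{kl}`, the span of the `f k` is the set of all `s` with
`s = ∑ k, s_{c k} f k`. -/

/-- `s = ∑ k, s_{c k} f k`. -/
def NFMem (c : Fin d → Fin n × Fin n) (f : Fin d → Matrix (Fin n) (Fin n) R)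
    (s : Matrix (Fin n) (Fin n) R) : Prop :=
  s = ∑ k, s (c k).1 (c k).2 • f k

/-- `f k` has the entry `δ_{kl}` at the position `c l`. -/
def NFDelta (c : Fin d → Fin n × Fin n) (f : Fin d → Matrix (Fin n) (Fin n) R) : Prop :=
  ∀ k l, f k (c l).1 (c l).2 = if k = l then 1 else 0

/-- The span of `f` is a subalgebra in normal form. -/
structure NFRel (c : Fin d → Fin n × Fin n) (f : Fin d → Matrix (Fin n) (Fin n) R) : Prop where
  delta : NFDelta c f
  one : NFMem c f 1
  mul : ∀ k l, NFMem c f (f k * f l)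

variable {c : Fin d → Fin n × Fin n} {f : Fin d → Matrix (Fin n) (Fin n) R}

theorem NFMem.map (φ : R →+* S) {s : Matrix (Fin n) (Fin n) R} (h : NFMem c f s) :
    NFMem c (fun k => φ.mapMatrix (f k)) (φ.mapMatrix s) := by
  have h1 := congrArg φ.mapMatrix (show s = _ from h)
  rw [map_sum] at h1
  simp only [mapMatrix_smul] at h1
  exact h1

theorem NFDelta.map (φ : R →+* S) (h : NFDelta c f) :
    NFDelta c (fun k => φ.mapMatrix (f k)) := by
  intro k l
  have := congrArg φ (h k l)
  simp only [RingHom.mapMatrix_apply, Matrix.map_apply, this]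
  split_ifs <;> simp

theorem NFRel.map (φ : R →+* S) (h : NFRel c f) : NFRel c (fun k => φ.mapMatrix (f k)) where
  delta := h.delta.map φ
  one := by simpa using h.one.map φ
  mul k l := by simpa using (h.mul k l).map φ

theorem NFMem.sum (h : NFDelta c f) (t : Fin d → R) : NFMem c f (∑ k, t k • f k) := by
  unfold NFMem
  congr 1
  ext1 l
  congr 1
  simp only [Matrix.sum_apply, Matrix.smul_apply, h _ l, smul_eq_mul, mul_ite, mul_one, mul_zero,
    Finset.sum_ite_eq', Finset.mem_univ, if_true]

theorem NFDelta.mem (h : NFDelta c f) (k : Fin d) : NFMem c f (f k) := by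
  have := NFMem.sum h (fun l => if l = k then 1 else 0)
  simpa using this

theorem NFMem.smul {s : Matrix (Fin n) (Fin n) R} (hs : NFMem c f s) (r : R) :
    NFMem c f (r • s) := by
  unfold NFMem at *
  conv_lhs => rw [hs, Finset.smul_sum]
  simp [mul_smul]

theorem NFMem.add {s t : Matrix (Fin n) (Fin n) R} (hs : NFMem c f s) (ht : NFMem c f t) :
    NFMem c f (s + t) := by
  unfold NFMem at *
  conv_lhs => rw [hs, ht]
  simp [add_smul, Finset.sum_add_distrib]

theorem NFMem.finset_sum {ι : Type*} (I : Finset ι) {s : ι → Matrix (Fin n) (Fin n) R}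
    (hs : ∀ i, NFMem c f (s i)) : NFMem c f (∑ i ∈ I, s i) := by
  classical
  induction I using Finset.induction_on with
  | empty => simp [NFMem]
  | insert i I hi ih => rw [Finset.sum_insert hi]; exact (hs i).add ih

/-- The subalgebra with normal form `f`. -/
def nfSubalgebra (h : NFRel c f) : Subalgebra R (Matrix (Fin n) (Fin n) R) where
  carrier := {s | NFMem c f s}
  add_mem' hs ht := NFMem.add hs ht
  mul_mem' {s t} hs ht := by
    have hs' : s = ∑ k, s (c k).1 (c k).2 • f k := hs
    have ht' : t = ∑ k, t (c k).1 (c k).2 • f k := ht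
    change NFMem c f (s * t)
    rw [hs', ht', Finset.sum_mul]
    refine NFMem.finset_sum _ fun k => ?_
    rw [Finset.mul_sum]
    refine NFMem.finset_sum _ fun l => ?_
    rw [smul_mul_smul_comm]
    exact (h.mul k l).smul _
  algebraMap_mem' r := by
    change NFMem c f _
    rw [Algebra.algebraMap_eq_smul_one]
    exact h.one.smul r

theorem mem_matExtend_iff_nfMem (φ : R →+* S) {A : Subalgebra R (Matrix (Fin n) (Fin n) R)}
    (h : NFDelta c f) (hA : ∀ s, s ∈ A ↔ NFMem c f s) (m : Matrix (Fin n) (Fin n) S) :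
    m ∈ matExtend φ A ↔ NFMem c (fun k => φ.mapMatrix (f k)) m := by
  have hf (k) : f k ∈ A := (hA _).2 (h.mem k)
  have hrel : NFRel c f :=
    ⟨h, (hA _).1 (one_mem A), fun k l => (hA _).1 (mul_mem (hf k) (hf l))⟩
  constructor
  · intro hm
    exact matExtend_le φ (B := nfSubalgebra (hrel.map φ)) (fun s hs => ((hA s).1 hs).map φ) hm
  · intro hm
    have hm' : m = ∑ k, m (c k).1 (c k).2 • φ.mapMatrix (f k) := hm
    rw [hm']
    exact sum_mem fun k _ => Subalgebra.smul_mem _ (mapMatrix_mem_matExtend φ (hf k)) _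

/-- Over a nontrivial ring, a family in normal form is part of a basis of `M_n(R)`. -/
theorem NFDelta.exists_basis [Nontrivial R] (h : NFDelta c f) :
    ∃ (e : ℕ) (b : Module.Basis (Fin d ⊕ Fin e) R (Matrix (Fin n) (Fin n) R)),
      ∀ k, b (Sum.inl k) = f k := by
  classical
  have hc : Function.Injective c := by
    intro k l hkl
    by_contra hne
    have h1 := h k l
    have h2 := h k k
    rw [hkl] at h2
    rw [h2] at h1
    simp [hne] at h1
  let J := {p : Fin n × Fin n // p ∉ Set.range c}
  let g : J → Matrix (Fin n) (Fin n) R := fun p => Matrix.single p.1.1 p.1.2 1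
  let F : Matrix (Fin n) (Fin n) R ≃ₗ[R] (Fin d ⊕ J → R) :=
    { toFun := fun s => Sum.elim (fun k => s (c k).1 (c k).2)
        (fun p => s p.1.1 p.1.2 - ∑ k, s (c k).1 (c k).2 * f k p.1.1 p.1.2)
      map_add' := by
        intro s t; ext (k | p)
        · simp
        · simp only [Matrix.add_apply, Sum.elim_inr, Pi.add_apply, add_mul, Finset.sum_add_distrib]
          ring
      map_smul' := by
        intro r s; ext (k | p)
        · simp
        · simp [mul_sub, Finset.mul_sum, mul_assoc]
      invFun := fun u => ∑ k, u (Sum.inl k) • f k + Matrix.of fun i j =>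
        if hp : (i, j) ∉ Set.range c then u (Sum.inr ⟨(i, j), hp⟩) else 0
      left_inv := by
        intro s
        ext i j
        by_cases hp : (i, j) ∈ Set.range c
        · obtain ⟨l, hl⟩ := hp
          have hi : i = (c l).1 := by rw [hl]
          have hj : j = (c l).2 := by rw [hl]
          subst hi hj
          simp [Matrix.sum_apply, h _ l]
        · simp only [Matrix.add_apply, Matrix.sum_apply, Matrix.smul_apply, Matrix.of_apply,
            dif_pos hp, Sum.elim_inl, Sum.elim_inr, smul_eq_mul]
          ring
      right_inv := by
        intro u
        have h0 (l) : (∑ k, u (Sum.inl k) • f k + Matrix.of fun i j =>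
            if hp : (i, j) ∉ Set.range c then u (Sum.inr ⟨(i, j), hp⟩) else 0)
            (c l).1 (c l).2 = u (Sum.inl l) := by
          simp [Matrix.sum_apply, h _ l]
        ext (l | p)
        · simp only [Sum.elim_inl]; exact h0 l
        · simp only [Sum.elim_inr, h0]
          have hp : (p.1.1, p.1.2) ∉ Set.range c := p.2
          simp only [Matrix.add_apply, Matrix.sum_apply, Matrix.smul_apply, Matrix.of_apply,
            dif_pos hp, smul_eq_mul]
          ring }
  let b0 := Module.Basis.ofEquivFun F
  let eJ := Fintype.equivFin J
  refine ⟨Fintype.card J, b0.reindex (Equiv.sumCongr (Equiv.refl _) eJ), fun k => ?_⟩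
  simp only [Module.Basis.reindex_apply, Equiv.sumCongr_symm, Equiv.sumCongr_apply, Equiv.refl_symm,
    Sum.map_inl, Equiv.refl_apply, b0, Module.Basis.coe_ofEquivFun]
  rw [LinearEquiv.symm_apply_eq]
  ext (l | p)
  · simp [F, h k l, Pi.single_apply, eq_comm]
  · simp [F, h k]

/-- A family that has a dual family over a local ring has an invertible maximal minor. -/
theorem exists_isUnit_det [IsLocalRing R] (f q : Fin d → Matrix (Fin n) (Fin n) R)
    (hq : ∀ k l, ∑ i, ∑ j, q l i j * f k i j = if k = l then 1 else 0) :
    ∃ c : Fin d → Fin n × Fin n,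
      IsUnit (Matrix.of fun k l => f k (c l).1 (c l).2 : Matrix (Fin d) (Fin d) R).det := by
  classical
  by_contra! hno
  have h1 : (Matrix.of fun l k => if k = l then 1 else 0 : Matrix (Fin d) (Fin d) R).det = 1 := by
    rw [← Matrix.det_one (n := Fin d)]
    congr 1
    ext l k
    simp [Matrix.one_apply, eq_comm]
  have h2 : (fun l k => if k = l then 1 else 0) = fun l : Fin d =>
      ∑ p : Fin n × Fin n, q l p.1 p.2 • fun k : Fin d => f k p.1 p.2 := by
    ext l k
    rw [← hq k l]
    simp [Fintype.sum_prod_type, Finset.sum_apply]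
  have h3 : Matrix.detRowAlternating (fun l k : Fin d => if k = l then (1 : R) else 0) ∈
      IsLocalRing.maximalIdeal R := by
    rw [h2]
    change (Matrix.detRowAlternating (R := R) (n := Fin d)).toMultilinearMap _ ∈ _
    rw [MultilinearMap.map_sum]
    refine sum_mem fun c _ => ?_
    rw [MultilinearMap.map_smul_univ, smul_eq_mul]
    refine Ideal.mul_mem_left _ _ ?_
    rw [IsLocalRing.mem_maximalIdeal, mem_nonunits_iff]
    have := hno c
    rw [← Matrix.det_transpose] at this
    exact this
  exact (Ideal.ne_top_iff_one _).1 (IsLocalRing.maximalIdeal.isMaximal R).ne_top (h1 ▸ h3)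

/-- The dual family of the first members of a basis. -/
theorem exists_dual {e : ℕ} (b : Module.Basis (Fin d ⊕ Fin e) R (Matrix (Fin n) (Fin n) R)) :
    ∃ q : Fin d → Matrix (Fin n) (Fin n) R, ∀ k l,
      ∑ i, ∑ j, q l i j * b (Sum.inl k) i j = if k = l then 1 else 0 := by
  classical
  refine ⟨fun l => Matrix.of fun i j => b.coord (Sum.inl l) (Matrix.single i j 1), fun k l => ?_⟩
  have h : b.coord (Sum.inl l) (b (Sum.inl k)) = if k = l then 1 else 0 := by
    simp [Finsupp.single_apply]
  rw [← h]
  conv_rhs => rw [Matrix.matrix_eq_sum_single (b (Sum.inl k))]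
  simp only [map_sum, Matrix.of_apply]
  refine Finset.sum_congr rfl fun i _ => Finset.sum_congr rfl fun j _ => ?_
  rw [show Matrix.single i j (b (Sum.inl k) i j) =
    b (Sum.inl k) i j • Matrix.single i j (1 : R) by simp, map_smul, smul_eq_mul, mul_comm]

end BaseChange

noncomputable section Molds

/-- The restriction of matrices of functions from `U` to `V ⊆ U`. -/
abbrev matRes {X : Scheme.{0}} {n : ℕ} {U V : X.Opens} (h : V ≤ U) :
    Matrix (Fin n) (Fin n) Γ(X, U) →+* Matrix (Fin n) (Fin n) Γ(X, V) :=
  (X.presheaf.map (homOfLE h).op).hom.mapMatrix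

/-- The germ at `x ∈ U` of a matrix of functions on `U`. -/
abbrev matGerm {X : Scheme.{0}} {n : ℕ} (U : X.Opens) (x : X) (h : x ∈ U) :
    Matrix (Fin n) (Fin n) Γ(X, U) →+* Matrix (Fin n) (Fin n) (X.presheaf.stalk x) :=
  (X.presheaf.germ U x h).hom.mapMatrix

/-- A subsheaf of `O_X`-algebras of `M_n(O_X)`. -/
@[ext]
structure MatSubalgebraSheaf (n : ℕ) (X : Scheme.{0}) where
  /-- the sections over `U` -/
  sec (U : X.Opens) : Subalgebra Γ(X, U) (Matrix (Fin n) (Fin n) Γ(X, U))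
  res_mem {U V : X.Opens} (h : V ≤ U) {s : Matrix (Fin n) (Fin n) Γ(X, U)} (hs : s ∈ sec U) :
    matRes h s ∈ sec V
  of_local {U : X.Opens} {s : Matrix (Fin n) (Fin n) Γ(X, U)}
    (hs : ∀ x ∈ U, ∃ (V : X.Opens) (h : V ≤ U), x ∈ V ∧ matRes h s ∈ sec V) : s ∈ sec U

section

variable {X : Scheme.{0}} {n : ℕ}

theorem matGerm_matRes {U V : X.Opens} (h : V ≤ U) (x : X) (hx : x ∈ V)
    (s : Matrix (Fin n) (Fin n) Γ(X, U)) :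
    matGerm V x hx (matRes h s) = matGerm U x (h hx) s := by
  ext i j
  exact X.presheaf.germ_res_apply (homOfLE h) x hx (s i j)

theorem matRes_matRes {U V W : X.Opens} (h : V ≤ U) (h' : W ≤ V)
    (s : Matrix (Fin n) (Fin n) Γ(X, U)) :
    matRes h' (matRes h s) = matRes (h'.trans h) s := by
  ext i j
  exact (congrArg (fun g => g.hom (s i j))
    (X.presheaf.map_comp (homOfLE h).op (homOfLE h').op)).symm

theorem matRes_self {U : X.Opens} (h : U ≤ U) (s : Matrix (Fin n) (Fin n) Γ(X, U)) :
    matRes h s = s := by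
  ext i j
  exact congrArg (fun g => g.hom (s i j)) (X.presheaf.map_id (op U))

theorem mat_ext_of_germ {U : X.Opens} {s t : Matrix (Fin n) (Fin n) Γ(X, U)}
    (h : ∀ x (hx : x ∈ U), matGerm U x hx s = matGerm U x hx t) : s = t := by
  ext i j
  refine TopCat.Presheaf.section_ext X.sheaf U _ _ fun x hx => ?_
  exact congrFun (congrFun (h x hx) i) j

theorem matGerm_eq {x : X} {U V : X.Opens} (hU : x ∈ U) (hV : x ∈ V)
    {s : Matrix (Fin n) (Fin n) Γ(X, U)} {t : Matrix (Fin n) (Fin n) Γ(X, V)}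
    (h : matGerm U x hU s = matGerm V x hV t) :
    ∃ (W : X.Opens) (hWU : W ≤ U) (hWV : W ≤ V), x ∈ W ∧ matRes hWU s = matRes hWV t := by
  have h1 (p : Fin n × Fin n) : ∃ (W : X.Opens) (hWU : W ≤ U) (hWV : W ≤ V), x ∈ W ∧
      (X.presheaf.map (homOfLE hWU).op).hom (s p.1 p.2) =
        (X.presheaf.map (homOfLE hWV).op).hom (t p.1 p.2) := by
    obtain ⟨W, hx, iU, iV, hW⟩ := X.presheaf.germ_eq x hU hV (s p.1 p.2) (t p.1 p.2)
      (congrFun (congrFun h p.1) p.2)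
    exact ⟨W, iU.le, iV.le, hx, hW⟩
  choose W hWU hWV hx hW using h1
  let W' : X.Opens := (U ⊓ V) ⊓ Finset.univ.inf W
  have hW'U : W' ≤ U := inf_le_left.trans inf_le_left
  have hW'V : W' ≤ V := inf_le_left.trans inf_le_right
  have hle (p) : W' ≤ W p := inf_le_right.trans (Finset.inf_le (Finset.mem_univ p))
  refine ⟨W', hW'U, hW'V, ⟨⟨hU, hV⟩, ?_⟩, ?_⟩
  · change x ∈ ((Finset.univ.inf W : X.Opens) : Set X)
    rw [Opens.coe_finset_inf]
    simp only [Finset.inf_eq_iInf, Set.iInf_eq_iInter, Set.mem_iInter]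
    exact fun p _ => hx p
  · ext i j
    have h2 := congrArg (X.presheaf.map (homOfLE (hle (i, j))).op).hom (hW (i, j))
    have e1 := congrArg (fun g => g.hom (s i j))
      (X.presheaf.map_comp (homOfLE (hWU (i, j))).op (homOfLE (hle (i, j))).op)
    have e2 := congrArg (fun g => g.hom (t i j))
      (X.presheaf.map_comp (homOfLE (hWV (i, j))).op (homOfLE (hle (i, j))).op)
    exact e1.trans (h2.trans e2.symm)

namespace MatSubalgebraSheaf

variable (A : MatSubalgebraSheaf n X)

/-- The stalk of `A` at `x`. -/
def stalk (x : X) :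
    Subalgebra (X.presheaf.stalk x) (Matrix (Fin n) (Fin n) (X.presheaf.stalk x)) where
  carrier := {m | ∃ (U : X.Opens) (hx : x ∈ U), ∃ s ∈ A.sec U, matGerm U x hx s = m}
  add_mem' := by
    rintro _ _ ⟨U, hU, s, hs, rfl⟩ ⟨V, hV, t, ht, rfl⟩
    have hUV : x ∈ U ⊓ V := ⟨hU, hV⟩
    refine ⟨U ⊓ V, hUV, _, add_mem (A.res_mem inf_le_left hs) (A.res_mem inf_le_right ht), ?_⟩
    rw [map_add, matGerm_matRes, matGerm_matRes]
  mul_mem' := by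
    rintro _ _ ⟨U, hU, s, hs, rfl⟩ ⟨V, hV, t, ht, rfl⟩
    have hUV : x ∈ U ⊓ V := ⟨hU, hV⟩
    refine ⟨U ⊓ V, hUV, _, mul_mem (A.res_mem inf_le_left hs) (A.res_mem inf_le_right ht), ?_⟩
    rw [map_mul, matGerm_matRes, matGerm_matRes]
  algebraMap_mem' r := by
    obtain ⟨U, hU, r, rfl⟩ := X.presheaf.exists_germ_eq r
    exact ⟨U, hU, _, Subalgebra.algebraMap_mem (A.sec U) r, mapMatrix_algebraMap _ _⟩

variable {A}

theorem germ_mem_stalk {U : X.Opens} {s : Matrix (Fin n) (Fin n) Γ(X, U)} (hs : s ∈ A.sec U)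
    (x : X) (hx : x ∈ U) : matGerm U x hx s ∈ A.stalk x :=
  ⟨U, hx, s, hs, rfl⟩

theorem exists_res_mem {U : X.Opens} {s : Matrix (Fin n) (Fin n) Γ(X, U)} {x : X} (hx : x ∈ U)
    (hs : matGerm U x hx s ∈ A.stalk x) :
    ∃ (V : X.Opens) (h : V ≤ U), x ∈ V ∧ matRes h s ∈ A.sec V := by
  obtain ⟨V, hV, t, ht, h⟩ := hs
  obtain ⟨W, hWV, hWU, hxW, hW⟩ := matGerm_eq hV hx h
  exact ⟨W, hWU, hxW, hW ▸ A.res_mem hWV ht⟩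

theorem mem_sec_iff {U : X.Opens} {s : Matrix (Fin n) (Fin n) Γ(X, U)} :
    s ∈ A.sec U ↔ ∀ x (hx : x ∈ U), matGerm U x hx s ∈ A.stalk x :=
  ⟨fun hs x hx => germ_mem_stalk hs x hx, fun h => A.of_local fun x hx => exists_res_mem hx (h x hx)⟩

theorem ext_of_stalk {A B : MatSubalgebraSheaf n X} (h : ∀ x, A.stalk x = B.stalk x) : A = B := by
  ext U s
  rw [mem_sec_iff, mem_sec_iff]
  simp only [h]

/-- A subsheaf of algebras defined by conditions on germs. -/
def ofGerm (B : ∀ x : X, Subalgebra (X.presheaf.stalk x)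
    (Matrix (Fin n) (Fin n) (X.presheaf.stalk x))) : MatSubalgebraSheaf n X where
  sec U :=
    { carrier := {s | ∀ x (hx : x ∈ U), matGerm U x hx s ∈ B x}
      add_mem' := fun hs ht x hx => by rw [map_add]; exact add_mem (hs x hx) (ht x hx)
      mul_mem' := fun hs ht x hx => by rw [map_mul]; exact mul_mem (hs x hx) (ht x hx)
      algebraMap_mem' := fun r x hx => by
        rw [matGerm, mapMatrix_algebraMap]
        exact Subalgebra.algebraMap_mem _ _ }
  res_mem h s hs x hx := by rw [matGerm_matRes]; exact hs x (h hx)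
  of_local {U s} hs x hx := by
    obtain ⟨V, h, hxV, hV⟩ := hs x hx
    rw [← matGerm_matRes h x hxV]
    exact hV x hxV

/-- The pullback of a subsheaf of algebras `A ⊆ M_n(O_X)` along `f : Y ⟶ X`: the image of
`f^* A` in `f^* M_n(O_X) = M_n(O_Y)`. Its sections are the matrices whose germ at every `y`
is in the `O_{Y,y}`-subalgebra generated by the image of the stalk of `A` at `f y`. -/
def pullback {Y : Scheme.{0}} (f : Y ⟶ X) (A : MatSubalgebraSheaf n X) : MatSubalgebraSheaf n Y :=
  ofGerm fun y => matExtend (f.stalkMap y).hom (A.stalk (f y))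

theorem stalkMap_matGerm {Y : Scheme.{0}} (f : Y ⟶ X) (U : X.Opens) (y : Y) (hy : f y ∈ U)
    (s : Matrix (Fin n) (Fin n) Γ(X, U)) :
    (f.stalkMap y).hom.mapMatrix (matGerm U (f y) hy s) =
      matGerm (f ⁻¹ᵁ U) y hy ((f.app U).hom.mapMatrix s) := by
  ext i j
  exact f.germ_stalkMap_apply U y hy (s i j)

theorem app_mem_pullback {Y : Scheme.{0}} (f : Y ⟶ X) {U : X.Opens}
    {s : Matrix (Fin n) (Fin n) Γ(X, U)} (hs : s ∈ A.sec U) :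
    (f.app U).hom.mapMatrix s ∈ (A.pullback f).sec (f ⁻¹ᵁ U) := by
  intro y hy
  have e := stalkMap_matGerm f U y hy s
  exact e ▸ mapMatrix_mem_matExtend _ (germ_mem_stalk hs _ _)

theorem stalk_pullback {Y : Scheme.{0}} (f : Y ⟶ X) (A : MatSubalgebraSheaf n X) (y : Y) :
    (A.pullback f).stalk y = matExtend (f.stalkMap y).hom (A.stalk (f y)) := by
  apply le_antisymm
  · rintro _ ⟨U, hy, s, hs, rfl⟩
    exact hs y hy
  · refine matExtend_le _ ?_
    rintro _ ⟨U, hy, s, hs, rfl⟩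
    rw [stalkMap_matGerm]
    exact germ_mem_stalk (app_mem_pullback f hs) y hy

theorem pullback_id (A : MatSubalgebraSheaf n X) : A.pullback (𝟙 X) = A := by
  refine ext_of_stalk fun x => ?_
  rw [stalk_pullback]
  have h : ((𝟙 X : X ⟶ X).stalkMap x).hom = RingHom.id _ :=
    congrArg CommRingCat.Hom.hom (Scheme.Hom.stalkMap_id X x)
  rw [h]
  exact matExtend_id _

theorem pullback_comp {Y Z : Scheme.{0}} (f : Y ⟶ X) (g : Z ⟶ Y) (A : MatSubalgebraSheaf n X) :
    A.pullback (g ≫ f) = (A.pullback f).pullback g := by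
  refine ext_of_stalk fun z => ?_
  rw [stalk_pullback, stalk_pullback, stalk_pullback, matExtend_matExtend]
  have h : ((g ≫ f).stalkMap z).hom = (g.stalkMap z).hom.comp (f.stalkMap (g z)).hom :=
    congrArg CommRingCat.Hom.hom (Scheme.Hom.stalkMap_comp g f z)
  rw [h]
  rfl

/-- If the pullback of `s` along an open immersion is a section of the pullback of `A`, then `s`
is locally a section of `A`. -/
theorem exists_res_mem_of_app_mem {Y : Scheme.{0}} (f : Y ⟶ X) [IsOpenImmersion f] {U : X.Opens}
    {s : Matrix (Fin n) (Fin n) Γ(X, U)}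
    (hs : (f.app U).hom.mapMatrix s ∈ (A.pullback f).sec (f ⁻¹ᵁ U)) (y : Y) (hy : f y ∈ U) :
    matGerm U (f y) hy s ∈ A.stalk (f y) := by
  have h := hs y hy
  rw [← stalkMap_matGerm] at h
  refine mem_of_matExtend_bijective _ ?_ h
  exact ConcreteCategory.bijective_of_isIso (f.stalkMap y)

end MatSubalgebraSheaf

end

end Molds

noncomputable section Molds

/-- A rank `d` mold of degree `n` on `X`: a subsheaf `A` of `O_X`-algebras of `M_n(O_X)` such that
`A` and `M_n(O_X)/A` are locally free and `A` has rank `d`. That is, near every point `M_n(O_X)`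
has a basis whose first `d` members are a basis of `A` (and then the classes of the others are a
basis of the quotient). -/
@[ext]
structure Mold (n d : ℕ) (X : Scheme.{0}) extends MatSubalgebraSheaf n X where
  locally_free (x : X) : ∃ (U : X.Opens) (_ : x ∈ U) (e : ℕ)
    (b : Module.Basis (Fin d ⊕ Fin e) Γ(X, U) (Matrix (Fin n) (Fin n) Γ(X, U))),
    ∀ (V : X.Opens) (h : V ≤ U), Subalgebra.toSubmodule (sec V) =
      Submodule.span Γ(X, V) (Set.range fun i : Fin d => matRes h (b (Sum.inl i)))

variable {X : Scheme.{0}} {n d : ℕ}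

namespace MatSubalgebraSheaf

/-- `A` has on `V` the normal form given by `c` and `f`. -/
structure IsNF (A : MatSubalgebraSheaf n X) (c : Fin d → Fin n × Fin n) (V : X.Opens)
    (f : Fin d → Matrix (Fin n) (Fin n) Γ(X, V)) : Prop where
  delta : NFDelta c f
  mem_iff (W : X.Opens) (h : W ≤ V) (s : Matrix (Fin n) (Fin n) Γ(X, W)) :
    s ∈ A.sec W ↔ NFMem c (fun k => matRes h (f k)) s

variable {A : MatSubalgebraSheaf n X} {c : Fin d → Fin n × Fin n} {V : X.Opens}
  {f : Fin d → Matrix (Fin n) (Fin n) Γ(X, V)}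

theorem IsNF.mem (h : A.IsNF c V f) (k : Fin d) : f k ∈ A.sec V := by
  rw [h.mem_iff V le_rfl]
  have := (h.delta.map (X.presheaf.map (homOfLE (le_refl V)).op).hom).mem k
  have e := matRes_self (le_refl V) (f k)
  rwa [e] at this

theorem IsNF.mem_iff' (h : A.IsNF c V f) (s : Matrix (Fin n) (Fin n) Γ(X, V)) :
    s ∈ A.sec V ↔ NFMem c f s := by
  rw [h.mem_iff V le_rfl]
  simp only [matRes_self]

theorem IsNF.rel (h : A.IsNF c V f) : NFRel c f where
  delta := h.delta
  one := (h.mem_iff' _).1 (one_mem _)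
  mul k l := (h.mem_iff' _).1 (mul_mem (h.mem k) (h.mem l))

theorem IsNF.res (h : A.IsNF c V f) {W : X.Opens} (hW : W ≤ V) :
    A.IsNF c W (fun k => matRes hW (f k)) where
  delta := h.delta.map _
  mem_iff W' hW' s := by
    rw [h.mem_iff W' (hW'.trans hW)]
    simp only [matRes_matRes]

theorem IsNF.mem_stalk_iff (h : A.IsNF c V f) {x : X} (hx : x ∈ V)
    (m : Matrix (Fin n) (Fin n) (X.presheaf.stalk x)) :
    m ∈ A.stalk x ↔ NFMem c (fun k => matGerm V x hx (f k)) m := by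
  constructor
  · rintro ⟨U, hU, s, hs, rfl⟩
    have hUV : x ∈ U ⊓ V := ⟨hU, hx⟩
    have h1 := (h.mem_iff (U ⊓ V) inf_le_right _).1 (A.res_mem inf_le_left hs)
    have h2 := h1.map (X.presheaf.germ (U ⊓ V) x hUV).hom
    have e (k) := matGerm_matRes (inf_le_right : U ⊓ V ≤ V) x hUV (f k)
    have e' := matGerm_matRes (inf_le_left : U ⊓ V ≤ U) x hUV s
    simp only [e, e'] at h2
    exact h2
  · intro hm
    have hm' : m = ∑ k, m (c k).1 (c k).2 • matGerm V x hx (f k) := hm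
    rw [hm']
    exact sum_mem fun k _ => Subalgebra.smul_mem _ (germ_mem_stalk (h.mem k) x hx) _

/-- It suffices to check a normal form on stalks. -/
theorem isNF_of_stalk (hf : NFDelta c f)
    (h : ∀ x (hx : x ∈ V) (m : Matrix (Fin n) (Fin n) (X.presheaf.stalk x)),
      m ∈ A.stalk x ↔ NFMem c (fun k => matGerm V x hx (f k)) m) : A.IsNF c V f where
  delta := hf
  mem_iff W hW s := by
    rw [mem_sec_iff]
    have e (x) (hx : x ∈ W) (k) := matGerm_matRes hW x hx (f k)
    constructor
    · intro hs
      refine mat_ext_of_germ fun x hx => ?_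
      have h1 := (h x (hW hx) _).1 (hs x hx)
      simp only [← e x hx] at h1
      refine Eq.trans h1 ?_
      rw [map_sum]
      refine Finset.sum_congr rfl fun k _ => ?_
      exact (mapMatrix_smul _ _ _).symm
    · intro hs x hx
      rw [h x (hW hx)]
      have h1 := hs.map (X.presheaf.germ W x hx).hom
      simp only [e x hx] at h1
      exact h1

theorem IsNF.pullback (h : A.IsNF c V f) {Y : Scheme.{0}} (g : Y ⟶ X) :
    (A.pullback g).IsNF c (g ⁻¹ᵁ V) (fun k => (g.app V).hom.mapMatrix (f k)) := by
  refine isNF_of_stalk (h.delta.map _) fun y hy m => ?_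
  rw [stalk_pullback, mem_matExtend_iff_nfMem _
    (h.delta.map (X.presheaf.germ V (g y) hy).hom) (fun s => h.mem_stalk_iff hy s)]
  have e (k) := stalkMap_matGerm g V y hy (f k)
  simp only [← e]

/-- A normal form gives a local basis. -/
theorem IsNF.locally_free (h : A.IsNF c V f) (x : X) (hx : x ∈ V) :
    ∃ (U : X.Opens) (_ : x ∈ U) (e : ℕ)
    (b : Module.Basis (Fin d ⊕ Fin e) Γ(X, U) (Matrix (Fin n) (Fin n) Γ(X, U))),
    ∀ (V : X.Opens) (h : V ≤ U), Subalgebra.toSubmodule (A.sec V) =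
      Submodule.span Γ(X, V) (Set.range fun i : Fin d => matRes h (b (Sum.inl i))) := by
  have hnt : Nontrivial Γ(X, V) := (X.presheaf.germ V x hx).hom.domain_nontrivial
  obtain ⟨e, b, hb⟩ := h.delta.exists_basis
  refine ⟨V, hx, e, b, fun W hW => le_antisymm ?_ ?_⟩
  · intro s hs
    have h1 : s = _ := (h.mem_iff W hW s).1 hs
    rw [h1]
    refine sum_mem fun k _ => Submodule.smul_mem _ _ (Submodule.subset_span ⟨k, ?_⟩)
    simp only [hb]
  · rw [Submodule.span_le]
    rintro _ ⟨k, rfl⟩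
    simp only [hb]
    exact A.res_mem hW (h.mem k)

/-- The normal form obtained from a local frame with an invertible minor. -/
theorem exists_isNF_of_isUnit_det {U : X.Opens} (b : Fin d → Matrix (Fin n) (Fin n) Γ(X, U))
    (hb : ∀ (V : X.Opens) (h : V ≤ U), Subalgebra.toSubmodule (A.sec V) =
      Submodule.span Γ(X, V) (Set.range fun i => matRes h (b i)))
    (c : Fin d → Fin n × Fin n)
    (hc : IsUnit (Matrix.of fun k l => b k (c l).1 (c l).2 : Matrix (Fin d) (Fin d) Γ(X, U)).det) :
    ∃ f, A.IsNF c U f := by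
  let M : Matrix (Fin d) (Fin d) Γ(X, U) := Matrix.of fun k l => b k (c l).1 (c l).2
  have hM : M⁻¹ * M = 1 := Matrix.nonsing_inv_mul M hc
  have hM' : M * M⁻¹ = 1 := Matrix.mul_nonsing_inv M hc
  let f : Fin d → Matrix (Fin n) (Fin n) Γ(X, U) := fun l => ∑ k, M⁻¹ l k • b k
  have hbf (k) : b k = ∑ l, M k l • f l := by
    have : ∑ l, M k l • f l = ∑ j, (M * M⁻¹) k j • b j := by
      simp only [f, Finset.smul_sum, smul_smul, Matrix.mul_apply, Finset.sum_smul]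
      exact Finset.sum_comm
    rw [this, hM']
    simp [Matrix.one_apply]
  have hf : NFDelta c f := by
    intro k l
    have h1 := congrFun (congrFun hM k) l
    rw [Matrix.one_apply] at h1
    rw [← h1]
    simp only [f, Matrix.sum_apply, Matrix.smul_apply, Matrix.mul_apply, smul_eq_mul, M,
      Matrix.of_apply]
  refine ⟨f, hf, fun W hW s => ?_⟩
  rw [← Subalgebra.mem_toSubmodule, hb W hW]
  have hfW := hf.map (X.presheaf.map (homOfLE hW).op).hom
  constructor
  · intro hs
    induction hs using Submodule.span_induction with
    | mem x hx =>
      obtain ⟨k, rfl⟩ := hx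
      have h1 : matRes hW (b k) = ∑ l, (X.presheaf.map (homOfLE hW).op).hom (M k l) •
          matRes hW (f l) := by
        conv_lhs => rw [hbf k]
        rw [map_sum]
        exact Finset.sum_congr rfl fun l _ => mapMatrix_smul _ _ _
      change NFMem c _ (matRes hW (b k))
      rw [h1]
      exact NFMem.sum hfW _
    | zero => simp [NFMem]
    | add x y _ _ hx hy => exact hx.add hy
    | smul r x _ hx => exact hx.smul r
  · intro hs
    have hs' : s = _ := hs
    rw [hs']
    refine sum_mem fun k _ => Submodule.smul_mem _ _ ?_
    have h1 : matRes hW (f k) = ∑ l, (X.presheaf.map (homOfLE hW).op).hom (M⁻¹ k l) •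
        matRes hW (b l) := by
      rw [map_sum]
      exact Finset.sum_congr rfl fun l _ => mapMatrix_smul _ _ _
    change matRes hW (f k) ∈ _
    rw [h1]
    exact sum_mem fun l _ => Submodule.smul_mem _ _ (Submodule.subset_span ⟨l, rfl⟩)

/-- It suffices that the minor is invertible at `x`. -/
theorem exists_isNF_of_isUnit_germ {U : X.Opens} (b : Fin d → Matrix (Fin n) (Fin n) Γ(X, U))
    (hb : ∀ (V : X.Opens) (h : V ≤ U), Subalgebra.toSubmodule (A.sec V) =
      Submodule.span Γ(X, V) (Set.range fun i => matRes h (b i)))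
    (c : Fin d → Fin n × Fin n) (x : X) (hx : x ∈ U)
    (hc : IsUnit (Matrix.of fun k l => matGerm U x hx (b k) (c l).1 (c l).2 :
      Matrix (Fin d) (Fin d) (X.presheaf.stalk x)).det) :
    ∃ V f, x ∈ V ∧ A.IsNF c V f := by
  let M : Matrix (Fin d) (Fin d) Γ(X, U) := Matrix.of fun k l => b k (c l).1 (c l).2
  have h1 : (Matrix.of fun k l => matGerm U x hx (b k) (c l).1 (c l).2 :
      Matrix (Fin d) (Fin d) (X.presheaf.stalk x)) = (X.presheaf.germ U x hx).hom.mapMatrix M := rfl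
  rw [h1, ← RingHom.map_det] at hc
  have hle := X.basicOpen_le M.det
  obtain ⟨f, hf⟩ := exists_isNF_of_isUnit_det (A := A) (U := X.basicOpen M.det)
    (fun k => matRes hle (b k))
    (fun V h => by rw [hb V (h.trans hle)]; simp only [matRes_matRes]) c (by
      have h2 : (Matrix.of fun k l => matRes hle (b k) (c l).1 (c l).2 :
        Matrix (Fin d) (Fin d) Γ(X, X.basicOpen M.det)) =
          (X.presheaf.map (homOfLE hle).op).hom.mapMatrix M := rfl
      rw [h2, ← RingHom.map_det]
      exact RingedSpace.isUnit_res_basicOpen X.toRingedSpace M.det)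
  exact ⟨_, f, (X.mem_basicOpen M.det x hx).2 hc, hf⟩

end MatSubalgebraSheaf

theorem Mold.exists_isNF (A : Mold n d X) (x : X) :
    ∃ (c : Fin d → Fin n × Fin n) (V : X.Opens) (f : _), x ∈ V ∧
      A.toMatSubalgebraSheaf.IsNF c V f := by
  obtain ⟨U, hx, e, b, hb⟩ := A.locally_free x
  obtain ⟨q, hq⟩ := exists_dual b
  obtain ⟨c, hc⟩ := exists_isUnit_det (fun k => matGerm U x hx (b (Sum.inl k)))
    (fun k => matGerm U x hx (q k)) (fun k l => by
      have h := congrArg (X.presheaf.germ U x hx).hom (hq k l)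
      simp only [map_sum, map_mul] at h
      refine Eq.trans h ?_
      split_ifs
      · exact map_one _
      · exact map_zero _)
  obtain ⟨V, f, hV, hf⟩ := MatSubalgebraSheaf.exists_isNF_of_isUnit_germ _ hb c x hx hc
  exact ⟨c, V, f, hV, hf⟩

/-- The pullback of molds. -/
def Mold.pullback {Y : Scheme.{0}} (g : Y ⟶ X) (A : Mold n d X) : Mold n d Y where
  toMatSubalgebraSheaf := A.toMatSubalgebraSheaf.pullback g
  locally_free y := by
    obtain ⟨c, V, f, hx, hf⟩ := A.exists_isNF (g y)
    exact (hf.pullback g).locally_free y hx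

end Molds

noncomputable section Molds

variable {X : Scheme.{0}} {n d : ℕ}

theorem Mold.ext' {A B : Mold n d X} (h : A.toMatSubalgebraSheaf = B.toMatSubalgebraSheaf) :
    A = B := by
  cases A; cases B; cases h; rfl

theorem Mold.pullback_id (A : Mold n d X) : A.pullback (𝟙 X) = A :=
  Mold.ext' (MatSubalgebraSheaf.pullback_id _)

theorem Mold.pullback_comp {Y Z : Scheme.{0}} (f : Y ⟶ X) (g : Z ⟶ Y) (A : Mold n d X) :
    A.pullback (g ≫ f) = (A.pullback f).pullback g :=
  Mold.ext' (MatSubalgebraSheaf.pullback_comp f g _)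

/-- The functor sending a scheme to the set of rank `d` molds of degree `n` on it. -/
def moldFunctor (n d : ℕ) : Scheme.{0}ᵒᵖ ⥤ Type where
  obj X := Mold n d X.unop
  map f := ↾fun A => A.pullback f.unop
  map_id _ := ConcreteCategory.hom_ext _ _ fun A => A.pullback_id
  map_comp f g := ConcreteCategory.hom_ext _ _ fun A => A.pullback_comp f.unop g.unop

/-! The functor of molds is a Zariski sheaf. -/

section Glue

/-- The pullback of matrices of functions. -/
abbrev matApp {X Y : Scheme.{0}} {n : ℕ} (f : Y ⟶ X) (U : X.Opens) :
    Matrix (Fin n) (Fin n) Γ(X, U) →+* Matrix (Fin n) (Fin n) Γ(Y, f ⁻¹ᵁ U) :=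
  (f.app U).hom.mapMatrix

theorem matApp_matRes {Y : Scheme.{0}} (f : Y ⟶ X) {U V : X.Opens} (h : V ≤ U)
    (h' : f ⁻¹ᵁ V ≤ f ⁻¹ᵁ U) (s : Matrix (Fin n) (Fin n) Γ(X, U)) :
    matApp f V (matRes h s) = matRes h' (matApp f U s) := by
  ext i j
  exact congrArg (fun g => g.hom (s i j)) (f.naturality (homOfLE h).op)

theorem matApp_comp {Y Z : Scheme.{0}} (f : Y ⟶ X) (g : Z ⟶ Y) (U : X.Opens)
    (s : Matrix (Fin n) (Fin n) Γ(X, U)) :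
    matApp (g ≫ f) U s = matApp g (f ⁻¹ᵁ U) (matApp f U s) := by
  ext i j
  exact congrArg (fun g => g.hom (s i j)) (Scheme.Hom.comp_app g f U)

theorem matApp_bijective {Y : Scheme.{0}} (f : Y ⟶ X) [IsOpenImmersion f] (U : X.Opens)
    (hU : U ≤ f.opensRange) :
    Function.Bijective (matApp (n := n) f U) := by
  have := f.isIso_app U hU
  have h := ConcreteCategory.bijective_of_isIso (f.app U)
  constructor
  · intro s t hst
    ext i j
    exact h.1 (congrFun (congrFun hst i) j)
  · intro s
    choose t ht using fun i j => h.2 (s i j)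
    exact ⟨Matrix.of t, by ext i j; exact ht i j⟩

theorem matExtend_injective {R S : Type*} [CommRing R] [CommRing S] (φ : R →+* S)
    (hφ : Function.Bijective φ) {A B : Subalgebra R (Matrix (Fin n) (Fin n) R)}
    (h : matExtend φ A = matExtend φ B) : A = B := by
  ext M
  constructor
  · intro hM
    exact mem_of_matExtend_bijective φ hφ (h ▸ mapMatrix_mem_matExtend φ hM)
  · intro hM
    exact mem_of_matExtend_bijective φ hφ (h ▸ mapMatrix_mem_matExtend φ hM)

variable {ι : Type*} {Y : ι → Scheme.{0}} (p : ∀ i, Y i ⟶ X)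

/-- Gluing subsheaves of algebras. -/
def MatSubalgebraSheaf.glue (A : ∀ i, MatSubalgebraSheaf n (Y i)) : MatSubalgebraSheaf n X where
  sec U :=
    { carrier := {s | ∀ i, matApp (p i) U s ∈ (A i).sec (p i ⁻¹ᵁ U)}
      add_mem' := fun hs ht i => by rw [map_add]; exact add_mem (hs i) (ht i)
      mul_mem' := fun hs ht i => by rw [map_mul]; exact mul_mem (hs i) (ht i)
      algebraMap_mem' := fun r i => by
        rw [matApp, mapMatrix_algebraMap]
        exact Subalgebra.algebraMap_mem _ _ }
  res_mem {U V} h s hs i := by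
    have h' : p i ⁻¹ᵁ V ≤ p i ⁻¹ᵁ U := fun x hx => h hx
    rw [matApp_matRes (p i) h h']
    exact (A i).res_mem h' (hs i)
  of_local {U s} hs i := by
    refine (A i).of_local fun y hy => ?_
    obtain ⟨V, h, hxV, hV⟩ := hs (p i y) hy
    have h' : p i ⁻¹ᵁ V ≤ p i ⁻¹ᵁ U := fun x hx => h hx
    refine ⟨p i ⁻¹ᵁ V, h', hxV, ?_⟩
    rw [← matApp_matRes (p i) h h']
    exact hV i

variable [∀ i, IsOpenImmersion (p i)] {A : ∀ i, MatSubalgebraSheaf n (Y i)}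

theorem MatSubalgebraSheaf.mem_glue
    (hA : ∀ (i j) (Z : Scheme.{0}) (g₁ : Z ⟶ Y i) (g₂ : Z ⟶ Y j), g₁ ≫ p i = g₂ ≫ p j →
      (A i).pullback g₁ = (A j).pullback g₂)
    {i : ι} {W : X.Opens} (hW : W ≤ (p i).opensRange)
    {t : Matrix (Fin n) (Fin n) Γ(X, W)} (ht : matApp (p i) W t ∈ (A i).sec (p i ⁻¹ᵁ W)) :
    t ∈ (glue p A).sec W := by
  intro j
  rw [mem_sec_iff]
  intro z hz
  obtain ⟨y, hy⟩ := hW hz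
  obtain ⟨w, hw1, hw2⟩ := Scheme.Pullback.exists_preimage_pullback (f := p i) (g := p j) y z hy
  subst hw2
  have h1 := app_mem_pullback (Limits.pullback.fst (p i) (p j)) ht
  have h2 : ∀ g : Limits.pullback (p i) (p j) ⟶ X, g = Limits.pullback.fst (p i) (p j) ≫ p i →
      matApp g W t ∈ ((A i).pullback (Limits.pullback.fst (p i) (p j))).sec (g ⁻¹ᵁ W) := by
    rintro _ rfl
    rw [matApp_comp]
    exact h1
  have h3 := h2 (Limits.pullback.snd (p i) (p j) ≫ p j) Limits.pullback.condition.symm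
  rw [matApp_comp, hA i j _ _ _ Limits.pullback.condition] at h3
  exact exists_res_mem_of_app_mem (Limits.pullback.snd (p i) (p j)) h3 w hz

theorem MatSubalgebraSheaf.pullback_glue
    (hA : ∀ (i j) (Z : Scheme.{0}) (g₁ : Z ⟶ Y i) (g₂ : Z ⟶ Y j), g₁ ≫ p i = g₂ ≫ p j →
      (A i).pullback g₁ = (A j).pullback g₂)
    (i : ι) : (glue p A).pullback (p i) = A i := by
  refine ext_of_stalk fun y => ?_
  rw [stalk_pullback]
  apply le_antisymm
  · refine matExtend_le _ ?_
    rintro _ ⟨W, hW, s, hs, rfl⟩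
    rw [stalkMap_matGerm]
    exact germ_mem_stalk (hs i) y hW
  · rintro _ ⟨V, hV, s, hs, rfl⟩
    have hV' : p i ⁻¹ᵁ (p i ''ᵁ V) ≤ V := ((p i).preimage_image_eq V).le
    have hyV : y ∈ p i ⁻¹ᵁ (p i ''ᵁ V) := ((p i).preimage_image_eq V).ge hV
    have hr : p i ''ᵁ V ≤ (p i).opensRange := (p i).image_le_opensRange V
    obtain ⟨t, ht⟩ := (matApp_bijective (n := n) (p i) (p i ''ᵁ V) hr).2 (matRes hV' s)
    have htm : t ∈ (glue p A).sec (p i ''ᵁ V) :=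
      mem_glue p hA hr (by rw [ht]; exact (A i).res_mem hV' hs)
    have h1 := stalkMap_matGerm (p i) (p i ''ᵁ V) y hyV t
    have h2 := matGerm_matRes hV' y hyV s
    rw [← h2, ← ht, ← h1]
    exact mapMatrix_mem_matExtend _ (germ_mem_stalk htm _ _)

theorem MatSubalgebraSheaf.glue_isNF
    (hA : ∀ (i j) (Z : Scheme.{0}) (g₁ : Z ⟶ Y i) (g₂ : Z ⟶ Y j), g₁ ≫ p i = g₂ ≫ p j →
      (A i).pullback g₁ = (A j).pullback g₂)
    {i : ι} {c : Fin d → Fin n × Fin n} {V : (Y i).Opens}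
    {f : Fin d → Matrix (Fin n) (Fin n) Γ(Y i, V)} (hf : (A i).IsNF c V f) :
    ∃ f', (glue p A).IsNF c (p i ''ᵁ V) f' := by
  have hV' : p i ⁻¹ᵁ (p i ''ᵁ V) ≤ V := ((p i).preimage_image_eq V).le
  have hr : p i ''ᵁ V ≤ (p i).opensRange := (p i).image_le_opensRange V
  have hinj := (matApp_bijective (n := n) (p i) (p i ''ᵁ V) hr).1
  choose f' hf' using fun k => (matApp_bijective (n := n) (p i) (p i ''ᵁ V) hr).2
    (matRes hV' (f k))
  have hf1 := hf.res hV'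
  refine ⟨f', ?_, fun W hW s => ?_⟩
  · intro k l
    have h1 := hf1.delta k l
    rw [← hf'] at h1
    have := (p i).isIso_app (p i ''ᵁ V) hr
    refine (ConcreteCategory.bijective_of_isIso ((p i).app (p i ''ᵁ V))).1 (Eq.trans h1 ?_)
    split_ifs
    · exact (map_one _).symm
    · exact (map_zero _).symm
  · have h' : p i ⁻¹ᵁ W ≤ p i ⁻¹ᵁ (p i ''ᵁ V) := fun x hx => hW hx
    have h1 : s ∈ (glue p A).sec W ↔ matApp (p i) W s ∈ (A i).sec (p i ⁻¹ᵁ W) :=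
      ⟨fun hs => hs i, fun hs => mem_glue p hA (hW.trans hr) hs⟩
    have e (k) := matApp_matRes (p i) hW h' (f' k)
    rw [h1, hf1.mem_iff _ h']
    simp only [← hf', ← e]
    constructor
    · intro hs
      refine (matApp_bijective (n := n) (p i) W (hW.trans hr)).1 (Eq.trans hs ?_)
      rw [map_sum]
      exact Finset.sum_congr rfl fun k _ => (mapMatrix_smul _ _ _).symm
    · intro hs
      exact hs.map ((p i).app W).hom

end Glue

theorem Mold.existsUnique_glue {ι : Type*} {Y : ι → Scheme.{0}} (p : ∀ i, Y i ⟶ X)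
    [∀ i, IsOpenImmersion (p i)] (hp : ∀ x : X, ∃ i y, p i y = x) (A : ∀ i, Mold n d (Y i))
    (hA : ∀ (i j) (Z : Scheme.{0}) (g₁ : Z ⟶ Y i) (g₂ : Z ⟶ Y j), g₁ ≫ p i = g₂ ≫ p j →
      (A i).pullback g₁ = (A j).pullback g₂) :
    ∃! B : Mold n d X, ∀ i, B.pullback (p i) = A i := by
  have hA' : ∀ (i j) (Z : Scheme.{0}) (g₁ : Z ⟶ Y i) (g₂ : Z ⟶ Y j), g₁ ≫ p i = g₂ ≫ p j →
      (A i).toMatSubalgebraSheaf.pullback g₁ = (A j).toMatSubalgebraSheaf.pullback g₂ :=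
    fun i j Z g₁ g₂ h => congrArg Mold.toMatSubalgebraSheaf (hA i j Z g₁ g₂ h)
  refine ⟨⟨MatSubalgebraSheaf.glue p fun i => (A i).toMatSubalgebraSheaf, fun x => ?_⟩,
    fun i => Mold.ext' (MatSubalgebraSheaf.pullback_glue p hA' i), fun B hB => Mold.ext' ?_⟩
  · obtain ⟨i, y, rfl⟩ := hp x
    obtain ⟨c, V, f, hV, hf⟩ := (A i).exists_isNF y
    obtain ⟨f', hf'⟩ := MatSubalgebraSheaf.glue_isNF p hA' hf
    exact hf'.locally_free _ ⟨y, hV, rfl⟩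
  · refine MatSubalgebraSheaf.ext_of_stalk fun x => ?_
    obtain ⟨i, y, rfl⟩ := hp x
    refine matExtend_injective ((p i).stalkMap y).hom
      (ConcreteCategory.bijective_of_isIso ((p i).stalkMap y)) ?_
    rw [← MatSubalgebraSheaf.stalk_pullback, ← MatSubalgebraSheaf.stalk_pullback,
      MatSubalgebraSheaf.pullback_glue p hA' i]
    exact congrArg (fun C : Mold n d (Y i) => C.stalk y) (hB i)

theorem moldFunctor_isSheaf (n d : ℕ) : Presheaf.IsSheaf Scheme.zariskiTopology (moldFunctor n d) := by
  rw [isSheaf_iff_isSheaf_of_type, Scheme.zariskiTopology, Scheme.grothendieckTopology,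
    Precoverage.isSheaf_toGrothendieck_iff_of_isStableUnderBaseChange]
  rintro X R hR x hx
  obtain ⟨(𝓤 : Scheme.OpenCover X), rfl⟩ := Scheme.exists_cover_of_mem_pretopology hR
  have h := Mold.existsUnique_glue (n := n) (d := d) 𝓤.f
    (fun y => ⟨𝓤.idx y, 𝓤.covers y⟩) (fun i => x (𝓤.f i) (.mk i))
    (fun i j Z g₁ g₂ h => hx g₁ g₂ (.mk i) (.mk j) h)
  obtain ⟨B, hB, hB'⟩ := h
  refine ⟨B, ?_, fun C hC => hB' C fun i => hC (𝓤.f i) (.mk i)⟩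
  rintro Y f ⟨i⟩
  exact hB i

end Molds

noncomputable section Molds

variable {X : Scheme.{0}} {n d : ℕ} {c : Fin d → Fin n × Fin n}

/-! The functor of molds is covered by affine schemes. -/

theorem MatSubalgebraSheaf.IsNF.unique {A : MatSubalgebraSheaf n X} {V : X.Opens}
    {f f' : Fin d → Matrix (Fin n) (Fin n) Γ(X, V)} (h : A.IsNF c V f) (h' : A.IsNF c V f') :
    f = f' := by
  ext1 k
  have h1 : f k = _ := (h'.mem_iff' (f k)).1 (h.mem k)
  rw [h1]
  simp [h.delta k]

theorem MatSubalgebraSheaf.eq_of_isNF {A B : MatSubalgebraSheaf n X}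
    {f : Fin d → Matrix (Fin n) (Fin n) Γ(X, ⊤)} (h : A.IsNF c ⊤ f) (h' : B.IsNF c ⊤ f) :
    A = B := by
  ext U s
  rw [h.mem_iff U le_top, h'.mem_iff U le_top]

/-- The subsheaf of algebras with a given global normal form. -/
def MatSubalgebraSheaf.ofNF {f : Fin d → Matrix (Fin n) (Fin n) Γ(X, ⊤)} (h : NFRel c f) :
    MatSubalgebraSheaf n X :=
  MatSubalgebraSheaf.ofGerm fun x => nfSubalgebra (h.map (X.presheaf.germ ⊤ x trivial).hom)

theorem MatSubalgebraSheaf.ofNF_isNF {f : Fin d → Matrix (Fin n) (Fin n) Γ(X, ⊤)}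
    (h : NFRel c f) : (MatSubalgebraSheaf.ofNF h).IsNF c ⊤ f := by
  refine isNF_of_stalk h.delta fun x hx m => ?_
  constructor
  · rintro ⟨U, hU, s, hs, rfl⟩
    exact hs x hU
  · intro hm
    have hm' : m = ∑ k, m (c k).1 (c k).2 • matGerm ⊤ x hx (f k) := hm
    rw [hm']
    refine sum_mem fun k _ => Subalgebra.smul_mem _ ?_ _
    refine germ_mem_stalk (A := MatSubalgebraSheaf.ofNF h) (U := ⊤) ?_ x hx
    intro y hy
    exact (h.delta.map (X.presheaf.germ ⊤ y trivial).hom).mem k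

/-- The mold with a given global normal form. -/
def Mold.ofNF {f : Fin d → Matrix (Fin n) (Fin n) Γ(X, ⊤)} (h : NFRel c f) : Mold n d X where
  toMatSubalgebraSheaf := MatSubalgebraSheaf.ofNF h
  locally_free x := (MatSubalgebraSheaf.ofNF_isNF h).locally_free x trivial

/-- Normal forms glue. -/
theorem MatSubalgebraSheaf.exists_isNF_top {A : MatSubalgebraSheaf n X}
    (hA : ∀ x : X, ∃ (V : X.Opens) (f : _), x ∈ V ∧ A.IsNF c V f) : ∃ f, A.IsNF c ⊤ f := by
  choose V f hV hf using hA
  have hcov : (⊤ : X.Opens) ≤ iSup V := fun x _ => Opens.mem_iSup.2 ⟨x, hV x⟩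
  have key (k : Fin d) (i j : Fin n) : ∃ s : Γ(X, ⊤), ∀ x : X,
      (X.presheaf.map (homOfLE (le_top : V x ≤ ⊤)).op).hom s = f x k i j := by
    obtain ⟨s, hs, -⟩ := X.sheaf.existsUnique_gluing' V ⊤ (fun x => homOfLE le_top) hcov
      (fun x => f x k i j) (by
        intro x y
        have h := ((hf x).res (inf_le_left : V x ⊓ V y ≤ V x)).unique
          ((hf y).res (inf_le_right : V x ⊓ V y ≤ V y))
        exact congrFun (congrFun (congrFun h k) i) j)
    exact ⟨s, hs⟩
  choose s hs using key
  let g : Fin d → Matrix (Fin n) (Fin n) Γ(X, ⊤) := fun k => Matrix.of (s k)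
  have hg (x : X) (k) : matRes (le_top : V x ≤ ⊤) (g k) = f x k := by
    ext i j
    exact hs k i j x
  have hgerm (x : X) (k) : matGerm ⊤ x trivial (g k) = matGerm (V x) x (hV x) (f x k) := by
    rw [← hg x k]
    exact (matGerm_matRes le_top x (hV x) (g k)).symm
  refine ⟨g, isNF_of_stalk ?_ fun x hx m => ?_⟩
  · intro k l
    refine TopCat.Presheaf.section_ext X.sheaf ⊤ _ _ fun x hx => ?_
    have h1 := congrFun (congrFun (hgerm x k) (c l).1) (c l).2
    have h2 := congrArg (X.presheaf.germ (V x) x (hV x)).hom ((hf x).delta k l)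
    refine h1.trans (h2.trans ?_)
    split_ifs
    · exact (map_one _).trans (map_one (X.presheaf.germ ⊤ x hx).hom).symm
    · exact (map_zero _).trans (map_zero (X.presheaf.germ ⊤ x hx).hom).symm
  · rw [(hf x).mem_stalk_iff (hV x)]
    have e := hgerm x
    simp only [← e]

/-- The open locus where a subsheaf of algebras has a normal form in the chart `c`. -/
def MatSubalgebraSheaf.chartLocus (A : MatSubalgebraSheaf n X) (c : Fin d → Fin n × Fin n) :
    X.Opens where
  carrier := {x | ∃ (V : X.Opens) (f : _), x ∈ V ∧ A.IsNF c V f}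
  is_open' := by
    rw [isOpen_iff_forall_mem_open]
    rintro x ⟨V, f, hx, hf⟩
    exact ⟨V, fun y hy => ⟨V, f, hy, hf⟩, V.isOpen, hx⟩

theorem Mold.mem_chartLocus_of_pullback (A : Mold n d X) {Y : Scheme.{0}} (g : Y ⟶ X) {W : Y.Opens}
    {F : Fin d → Matrix (Fin n) (Fin n) Γ(Y, W)}
    (hF : (A.pullback g).toMatSubalgebraSheaf.IsNF c W F) (y : Y) (hy : y ∈ W) :
    g y ∈ A.toMatSubalgebraSheaf.chartLocus c := by
  obtain ⟨c', V, f, hV, hf⟩ := A.exists_isNF (g y)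
  have hb : ∀ (W : X.Opens) (h : W ≤ V), Subalgebra.toSubmodule (A.sec W) =
      Submodule.span Γ(X, W) (Set.range fun i => matRes h (f i)) := by
    intro W h
    refine le_antisymm ?_ ?_
    · intro s hs
      have h1 : s = _ := (hf.mem_iff W h s).1 hs
      rw [h1]
      exact sum_mem fun k _ => Submodule.smul_mem _ _ (Submodule.subset_span ⟨k, rfl⟩)
    · rw [Submodule.span_le]
      rintro _ ⟨k, rfl⟩
      exact A.res_mem h (hf.mem k)
  refine MatSubalgebraSheaf.exists_isNF_of_isUnit_germ f hb c (g y) hV ?_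
  let φ := (g.stalkMap y).hom
  have hφ : IsLocalHom φ := inferInstanceAs (IsLocalHom (g.stalkMap y).hom)
  refine isUnit_of_map_unit φ _ ?_
  have h1 (l) : matGerm W y hy (F l) ∈
      matExtend φ (A.toMatSubalgebraSheaf.stalk (g y)) := by
    rw [← MatSubalgebraSheaf.stalk_pullback]
    exact MatSubalgebraSheaf.germ_mem_stalk (hF.mem l) y hy
  have h2 (l) := (mem_matExtend_iff_nfMem φ (hf.delta.map (X.presheaf.germ V (g y) hV).hom)
    (fun s => hf.mem_stalk_iff hV s) _).1 (h1 l)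
  have hδ := hF.delta.map (Y.presheaf.germ W y hy).hom
  rw [RingHom.map_det]
  refine Matrix.isUnit_det_of_left_inverse
    (B := Matrix.of fun l k => matGerm W y hy (F l) (c' k).1 (c' k).2) ?_
  ext l m
  have h3 := congrFun (congrFun (h2 l) (c m).1) (c m).2
  rw [Matrix.one_apply, ← hδ l m]
  refine Eq.trans ?_ h3.symm
  rw [Matrix.sum_apply, Matrix.mul_apply]
  rfl

/-- The polynomial ring in the entries of `d` matrices. -/
abbrev FramePoly (n d : ℕ) : Type := MvPolynomial (Fin d × Fin n × Fin n) ℤ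

/-- The generic matrices. -/
def genericFrame (k : Fin d) : Matrix (Fin n) (Fin n) (FramePoly n d) :=
  Matrix.of fun i j => MvPolynomial.X (k, i, j)

/-- The difference `s - ∑ m, s_{c m} u_m` for the generic matrices `u_m`. -/
def chartDefect (c : Fin d → Fin n × Fin n) (s : Matrix (Fin n) (Fin n) (FramePoly n d)) :
    Matrix (Fin n) (Fin n) (FramePoly n d) :=
  s - ∑ m, s (c m).1 (c m).2 • genericFrame m

/-- The relations of the normal form in the chart `c`. -/
def chartIdeal (c : Fin d → Fin n × Fin n) : Ideal (FramePoly n d) :=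
  Ideal.span ({r | ∃ k l, r = genericFrame k (c l).1 (c l).2 - if k = l then 1 else 0} ∪
    {r | ∃ i j, r = chartDefect c 1 i j} ∪
    {r | ∃ k l i j, r = chartDefect c (genericFrame k * genericFrame l) i j})

/-- The coordinate ring of the chart `c`. -/
abbrev ChartRing (c : Fin d → Fin n × Fin n) : Type :=
  FramePoly n d ⧸ chartIdeal c

/-- The universal normal form in the chart `c`. -/
def chartFrame (c : Fin d → Fin n × Fin n) (k : Fin d) : Matrix (Fin n) (Fin n) (ChartRing c) :=
  Matrix.of fun i j => Ideal.Quotient.mk (chartIdeal c) (MvPolynomial.X (k, i, j))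

theorem chartFrame_rel (c : Fin d → Fin n × Fin n) : NFRel c (chartFrame c) := by
  let u : Fin d → Matrix (Fin n) (Fin n) (FramePoly n d) := genericFrame
  let π := Ideal.Quotient.mk (chartIdeal c)
  have hu (k) : chartFrame c k = π.mapMatrix (u k) := rfl
  have hmem (s : Matrix (Fin n) (Fin n) (FramePoly n d))
      (hs : ∀ i j, chartDefect c s i j ∈ chartIdeal c) :
      NFMem c (chartFrame c) (π.mapMatrix s) := by
    have h1 : π.mapMatrix (s - ∑ m, s (c m).1 (c m).2 • u m) = 0 := by
      ext i j
      exact Ideal.Quotient.eq_zero_iff_mem.2 (hs i j)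
    rw [map_sub, sub_eq_zero, map_sum] at h1
    simp only [mapMatrix_smul] at h1
    exact h1
  refine ⟨fun k l => ?_, ?_, fun k l => ?_⟩
  · have h1 : u k (c l).1 (c l).2 - (if k = l then 1 else 0) ∈ chartIdeal c :=
      Ideal.subset_span (Or.inl (Or.inl ⟨k, l, rfl⟩))
    have h2 := Ideal.Quotient.eq_zero_iff_mem.2 h1
    rw [map_sub, sub_eq_zero] at h2
    refine h2.trans ?_
    split_ifs <;> simp
  · have := hmem 1 (fun i j => Ideal.subset_span (Or.inl (Or.inr ⟨i, j, rfl⟩)))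
    rwa [map_one] at this
  · have := hmem (u k * u l) (fun i j => Ideal.subset_span (Or.inr ⟨k, l, i, j, rfl⟩))
    rwa [map_mul] at this

theorem exists_chartRing_hom {R : Type*} [CommRing R] {f : Fin d → Matrix (Fin n) (Fin n) R}
    (hf : NFRel c f) : ∃ φ : ChartRing c →+* R, ∀ k, φ.mapMatrix (chartFrame c k) = f k := by
  let ψ : FramePoly n d →+* R :=
    MvPolynomial.eval₂Hom (Int.castRingHom R) (fun p => f p.1 p.2.1 p.2.2)
  let u : Fin d → Matrix (Fin n) (Fin n) (FramePoly n d) := genericFrame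
  have hu (k) : ψ.mapMatrix (u k) = f k := by
    ext i j
    simp [ψ, u, genericFrame]
  have hmem (s : Matrix (Fin n) (Fin n) (FramePoly n d))
      (hs : NFMem c f (ψ.mapMatrix s)) (i j) :
      ψ (chartDefect c s i j) = 0 := by
    have h1 : ψ.mapMatrix (s - ∑ m, s (c m).1 (c m).2 • u m) = 0 := by
      rw [map_sub, sub_eq_zero, map_sum]
      simp only [mapMatrix_smul, hu]
      exact hs
    exact congrFun (congrFun h1 i) j
  have hψ : ∀ a ∈ chartIdeal c, ψ a = 0 := by
    intro a ha
    have hle : chartIdeal c ≤ RingHom.ker ψ := by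
      rw [chartIdeal, Ideal.span_le]
      rintro _ ((⟨k, l, rfl⟩ | ⟨i, j, rfl⟩) | ⟨k, l, i, j, rfl⟩)
      · refine (map_sub ψ _ _).trans (sub_eq_zero.2 ?_)
        refine (congrFun (congrFun (hu k) (c l).1) (c l).2).trans ((hf.delta k l).trans ?_)
        split_ifs <;> simp
      · exact hmem 1 (by rw [map_one]; exact hf.one) i j
      · exact hmem (u k * u l) (by rw [map_mul, hu, hu]; exact hf.mul k l) i j
    exact hle ha
  refine ⟨Ideal.Quotient.lift _ ψ hψ, fun k => ?_⟩
  ext i j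
  exact congrFun (congrFun (hu k) i) j

theorem chartRing_hom_ext {R : Type*} [CommRing R] {φ ψ : ChartRing c →+* R}
    (h : ∀ k, φ.mapMatrix (chartFrame c k) = ψ.mapMatrix (chartFrame c k)) : φ = ψ := by
  refine Ideal.Quotient.ringHom_ext (MvPolynomial.ringHom_ext (fun r => by simp) ?_)
  rintro ⟨k, i, j⟩
  exact congrFun (congrFun (h k) i) j

end Molds

noncomputable section Molds

variable {X : Scheme.{0}} {n d : ℕ} {c : Fin d → Fin n × Fin n}

/-- The affine scheme of the chart `c`. -/
abbrev chartScheme (c : Fin d → Fin n × Fin n) : Scheme.{0} := Spec (.of (ChartRing c))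

/-- The homomorphism of global functions induced by a morphism to the chart. -/
def chartHom (g : X ⟶ chartScheme c) : ChartRing c →+* Γ(X, ⊤) :=
  ((Scheme.ΓSpecIso (.of (ChartRing c))).inv ≫ g.appTop).hom

theorem chartHom_injective : Function.Injective (chartHom (X := X) (c := c)) := by
  intro g h e
  exact ext_to_Spec (CommRingCat.hom_ext e)

theorem chartHom_surjective : Function.Surjective (chartHom (X := X) (c := c)) := by
  intro φ
  refine ⟨X.toSpecΓ ≫ Spec.map (CommRingCat.ofHom φ), ?_⟩
  refine congrArg CommRingCat.Hom.hom (a₂ := CommRingCat.ofHom φ) ?_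
  rw [Scheme.Hom.comp_appTop, ← Scheme.ΓSpecIso_inv_naturality_assoc, Scheme.toSpecΓ_appTop]
  simp

/-- The universal mold on the chart. -/
def chartMold (c : Fin d → Fin n × Fin n) : Mold n d (chartScheme c) :=
  Mold.ofNF ((chartFrame_rel c).map (Scheme.ΓSpecIso (.of (ChartRing c))).inv.hom)

theorem chartMold_pullback_isNF (g : X ⟶ chartScheme c) :
    ((chartMold c).pullback g).toMatSubalgebraSheaf.IsNF c ⊤
      (fun k => (chartHom g).mapMatrix (chartFrame c k)) :=
  (MatSubalgebraSheaf.ofNF_isNF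
    ((chartFrame_rel c).map (Scheme.ΓSpecIso (.of (ChartRing c))).inv.hom)).pullback g

theorem chartMold_pullback_injective :
    Function.Injective fun g : X ⟶ chartScheme c => (chartMold c).pullback g := by
  intro g h e
  refine chartHom_injective (chartRing_hom_ext fun k => ?_)
  have h1 := chartMold_pullback_isNF h
  rw [← show (chartMold c).pullback g = (chartMold c).pullback h from e] at h1
  exact congrFun ((chartMold_pullback_isNF g).unique h1) k

theorem exists_chartMold_pullback (A : Mold n d X) {f : Fin d → Matrix (Fin n) (Fin n) Γ(X, ⊤)}
    (hf : A.toMatSubalgebraSheaf.IsNF c ⊤ f) :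
    ∃ g : X ⟶ chartScheme c, (chartMold c).pullback g = A := by
  obtain ⟨φ, hφ⟩ := exists_chartRing_hom hf.rel
  obtain ⟨g, rfl⟩ := chartHom_surjective φ
  refine ⟨g, Mold.ext' (MatSubalgebraSheaf.eq_of_isNF (f := f) ?_ hf)⟩
  have h1 := chartMold_pullback_isNF g
  simp only [hφ] at h1
  exact h1

theorem exists_chartMold_pullback_locus (A : Mold n d X) (c : Fin d → Fin n × Fin n) :
    ∃ g : (A.chartLocus c : Scheme.{0}) ⟶ chartScheme c,
      (chartMold c).pullback g = A.pullback (A.chartLocus c).ι := by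
  obtain ⟨f, hf⟩ := MatSubalgebraSheaf.exists_isNF_top (c := c)
    (A := (A.pullback (A.chartLocus c).ι).toMatSubalgebraSheaf) (fun u => by
      obtain ⟨V, f, hV, hf⟩ : (A.chartLocus c).ι u ∈ A.chartLocus c := u.2
      exact ⟨_, _, hV, hf.pullback (A.chartLocus c).ι⟩)
  exact exists_chartMold_pullback _ hf

/-- The chart `c` as a map of functors. -/
def chartMap (c : Fin d → Fin n × Fin n) : yoneda.obj (chartScheme c) ⟶ moldFunctor n d :=
  yonedaEquiv.symm (chartMold c)

theorem chartMap_app (g : X ⟶ chartScheme c) :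
    (chartMap c).app (op X) g = (chartMold c).pullback g := rfl

/-- The mold corresponding to a map of functors. -/
def moldOfYoneda (α : yoneda.obj X ⟶ moldFunctor n d) : Mold n d X := α.app (op X) (𝟙 X)

theorem yoneda_app_eq (α : yoneda.obj X ⟶ moldFunctor n d) {Y : Scheme.{0}} (g : Y ⟶ X) :
    α.app (op Y) g = Mold.pullback g (moldOfYoneda α) := by
  have h := ConcreteCategory.congr_hom (α.naturality g.op) (𝟙 X)
  have e : (ConcreteCategory.hom ((yoneda.obj X).map g.op)) (𝟙 X) = g := Category.comp_id g
  exact (congrArg (α.app (op Y)) e).symm.trans h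

theorem chartMap_isOpenImmersion (c : Fin d → Fin n × Fin n) :
    MorphismProperty.presheaf @IsOpenImmersion (chartMap c) := by
  refine MorphismProperty.relative.of_exists fun T α => ?_
  let A : Mold n d T := moldOfYoneda α
  obtain ⟨g, hg⟩ := exists_chartMold_pullback_locus A c
  refine ⟨A.chartLocus c, yoneda.map g, (A.chartLocus c).ι, ?_, inferInstance⟩
  refine IsPullback.of_forall_isPullback_app fun S => ?_
  rw [Limits.Types.isPullback_iff]
  refine ⟨?_, ?_, ?_⟩
  · refine ConcreteCategory.hom_ext _ _ fun (u : S.unop ⟶ _) => ?_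
    change (chartMold c).pullback (u ≫ g) = α.app (op S.unop) (u ≫ (A.chartLocus c).ι)
    refine Eq.trans ?_ (yoneda_app_eq α (u ≫ (A.chartLocus c).ι)).symm
    rw [Mold.pullback_comp, Mold.pullback_comp, hg]
  · rintro (u : S.unop ⟶ _) (v : S.unop ⟶ _) ⟨-, h⟩
    exact (cancel_mono (A.chartLocus c).ι).1 h
  · intro (u : S.unop ⟶ chartScheme c) (v : S.unop ⟶ T) h
    have h' : (chartMold c).pullback u = A.pullback v := Eq.trans h (yoneda_app_eq α v)
    have hr : Set.range v ⊆ Set.range (A.chartLocus c).ι := by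
      rintro _ ⟨s, rfl⟩
      rw [Scheme.Opens.range_ι]
      have h1 := chartMold_pullback_isNF u
      rw [h'] at h1
      exact A.mem_chartLocus_of_pullback v h1 s trivial
    refine ⟨IsOpenImmersion.lift (A.chartLocus c).ι v hr, ?_, IsOpenImmersion.lift_fac _ _ _⟩
    apply chartMold_pullback_injective
    change (chartMold c).pullback (IsOpenImmersion.lift (A.chartLocus c).ι v hr ≫ g) = (chartMold c).pullback u
    rw [Mold.pullback_comp, hg, ← Mold.pullback_comp, IsOpenImmersion.lift_fac, h']

theorem chartMap_isLocallySurjective (n d : ℕ) :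
    Presheaf.IsLocallySurjective Scheme.zariskiTopology
      (Limits.Sigma.desc fun c : Fin d → Fin n × Fin n => chartMap c) where
  imageSieve_mem {X} (A : Mold n d X) := by
    have hcov : IsOpenCover fun c : Fin d → Fin n × Fin n => A.chartLocus c := by
      rw [IsOpenCover, eq_top_iff]
      intro x _
      obtain ⟨c, V, f, hV, hf⟩ := A.exists_isNF x
      exact Opens.mem_iSup.2 ⟨c, V, f, hV, hf⟩
    refine GrothendieckTopology.superset_covering _ ?_
      (Scheme.Cover.mem_grothendieckTopology (X.openCoverOfIsOpenCover _ hcov))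
    rw [Sieve.generate_le_iff]
    rintro Y f ⟨c⟩
    obtain ⟨g, hg⟩ := exists_chartMold_pullback_locus A c
    refine ⟨(Limits.Sigma.ι (fun c : Fin d → Fin n × Fin n => yoneda.obj (chartScheme c)) c).app
      (op _) g, ?_⟩
    have h1 := Limits.Sigma.ι_desc (fun c : Fin d → Fin n × Fin n => chartMap c) c
    have h2 := ConcreteCategory.congr_hom (NatTrans.congr_app h1 (op (A.chartLocus c : Scheme.{0}))) g
    exact h2.trans hg

/-- The functor of molds is representable. -/
instance moldFunctor_isRepresentable (n d : ℕ) : (moldFunctor n d).IsRepresentable :=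
  have := chartMap_isLocallySurjective n d
  Scheme.LocalRepresentability.isRepresentable
    (F := ⟨moldFunctor n d, moldFunctor_isSheaf n d⟩)
    (f := fun c : Fin d → Fin n × Fin n => chartMap c) chartMap_isOpenImmersion

/-- The moduli scheme of rank `d` molds of degree `n`: the scheme representing the functor of
molds. -/
def MoldScheme (n d : ℕ) : Scheme.{0} := (moldFunctor n d).reprX

/-- The universal mold. -/
def universalMold (n d : ℕ) : Mold n d (MoldScheme n d) := (moldFunctor n d).reprx

/-- The fibre `A(x) ⊆ M_n(k(x))` of a mold at a point: the image of `A ⊗ k(x)`. -/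
def Mold.fiber (A : Mold n d X) (x : X) :
    Subalgebra (X.residueField x) (Matrix (Fin n) (Fin n) (X.residueField x)) :=
  matExtend (X.residue x).hom (A.stalk x)

end Molds

/-! ### The exact sequence of Hochschild cohomology -/

section ExactSequence

/-! The exact sequence is formal. The derivations are exactly the Hochschild 1-cocycles
(`derivations_eq_ker`), so they map onto `H¹` with the coboundaries as kernel. The coboundary `d⁰`
is the negative of the commutator map `matQuotToDer` (`hochschildD0_matQuot`), so the two have the
same image. The class of `X` is killed by the commutator map exactly when `X` normalizes `A`.

Counting dimensions along the sequence gives `dim Der + dim N(A) = dim H¹ + n²`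
(`finrank_derivations_add`); the dimension of `A` drops out. It remains to identify the tangent
space at `x` with the derivations of the fibre `A(x)` into `M_n(k(x))/A(x)`.

Near `x` the universal mold has a frame `F k` in normal form: at `d` chosen positions `c l` its
entries are `δ_{kl}`. A tangent vector is a point derivation `D` of the local ring. Applying `D` to
the entries of the frame and taking classes modulo `A(x)` gives a linear map on `A(x)`. The class of
`D(s)` depends only on the value of `s` at `x` (`frameDerivation_eq`), so the product rule for
matrices makes this map a derivation.

The map from `D` to derivations is bijective because of the normalization. The entries at the
positions `c l` are constants, so `D(F k)` vanishes there, whereas an element of `A(x)` is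
determined by its entries there. Hence the class of `D(F k)` determines `D(F k)`, and the universal
property then determines `D` (`pointDerivation_eq_zero`). Conversely, the values of a derivation on
the frame have representatives `e k` vanishing at these positions. The Leibniz rule says precisely
that the matrices `F k(x) + e k ε` span a subalgebra in normal form over the dual numbers
(`exists_dual_frame`). This is a mold on the spectrum of the dual numbers, so it comes from a
morphism to the moduli scheme, which is a tangent vector at `x` with the required frame derivatives
(`exists_matDeriv_eq`). -/

/-- The coboundary of a 1-cochain is its defect in the Leibniz rule. -/
theorem derivations_eq_ker (k : Type*) [CommRing k] (A : Type*) [Ring A] [Algebra k A]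
    (M : Type*) [AddCommGroup M] [Module k M] [Module A M] [Module Aᵐᵒᵖ M]
    [SMulCommClass A Aᵐᵒᵖ M] [IsScalarTower k A M] [IsScalarTower k Aᵐᵒᵖ M] :
    derivations k A M = LinearMap.ker (hochschildD1 k A M) := by
  ext f
  rw [LinearMap.mem_ker]
  have key (a b : A) : hochschildD1 k A M f a b = 0 ↔
      f (a * b) = a • f b + MulOpposite.op b • f a := by
    change a • f b - f (a * b) + MulOpposite.op b • f a = 0 ↔ _
    rw [sub_add_eq_add_sub, sub_eq_zero, eq_comm]
  constructor
  · intro hf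
    ext a b
    exact (key a b).2 (hf a b)
  · intro hf a b
    exact (key a b).1 (by rw [hf]; rfl)

theorem derivationsToH1_surjective (k : Type*) [CommRing k] (A : Type*) [Ring A] [Algebra k A]
    (M : Type*) [AddCommGroup M] [Module k M] [Module A M] [Module Aᵐᵒᵖ M]
    [SMulCommClass A Aᵐᵒᵖ M] [IsScalarTower k A M] [IsScalarTower k Aᵐᵒᵖ M] :
    Function.Surjective (derivationsToH1 k A M) := by
  rintro ⟨f, hf⟩
  exact ⟨⟨f, by rwa [derivations_eq_ker]⟩, rfl⟩

theorem derivationsToH1_eq_zero_iff {k : Type*} [CommRing k] {A : Type*} [Ring A] [Algebra k A]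
    {M : Type*} [AddCommGroup M] [Module k M] [Module A M] [Module Aᵐᵒᵖ M]
    [SMulCommClass A Aᵐᵒᵖ M] [IsScalarTower k A M] [IsScalarTower k Aᵐᵒᵖ M]
    (f : derivations k A M) :
    derivationsToH1 k A M f = 0 ↔ f.1 ∈ LinearMap.range (hochschildD0 k A M) :=
  Submodule.Quotient.mk_eq_zero _

variable {k : Type*} [Field k] {n : ℕ} (A : Subalgebra k (Matrix (Fin n) (Fin n) k))

theorem normalizerQuotToMatQuot_injective : Function.Injective (normalizerQuotToMatQuot A) := by
  rw [injective_iff_map_eq_zero]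
  rintro ⟨X⟩ h
  exact (Submodule.Quotient.mk_eq_zero _).2
    ((Submodule.Quotient.mk_eq_zero (Subalgebra.toSubmodule A)).1 h)

theorem matToDer_eq_zero_iff (X : Matrix (Fin n) (Fin n) k) :
    matToDer A X = 0 ↔ X ∈ matNormalizer A := by
  constructor
  · intro h a ha
    have h1 := congrArg (fun f : derivations k A (MatQuot A) => f.1 ⟨a, ha⟩) h
    exact (Submodule.Quotient.mk_eq_zero (Subalgebra.toSubmodule A)).1 h1
  · intro h
    refine Subtype.ext (LinearMap.ext fun a => ?_)
    exact (Submodule.Quotient.mk_eq_zero (Subalgebra.toSubmodule A)).2 (h a.1 a.2)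

theorem exact_normalizerQuotToMatQuot_matQuotToDer :
    Function.Exact (normalizerQuotToMatQuot A) (matQuotToDer A) := by
  rintro ⟨X⟩
  refine (matToDer_eq_zero_iff A X).trans ⟨fun h => ⟨Submodule.Quotient.mk ⟨X, h⟩, rfl⟩, ?_⟩
  rintro ⟨⟨Y⟩, hY⟩
  have h1 : Y.1 - X ∈ A :=
    (Submodule.Quotient.eq (Subalgebra.toSubmodule A)).1 hY
  -- Since `A` lies in its normalizer, changing `Y` by an element of `A` does not leave the
  -- normalizer.
  have h2 : Y.1 - X ∈ matNormalizer A := (matToDer_eq_zero_iff A _).1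
    (toSubmodule_le_ker_matToDer A h1)
  simpa using sub_mem Y.2 h2

/-- The two conventions differ by a sign, `aX - Xa` against `Xa - aX`. This does not affect images,
but explains the witnesses `-m` in the exactness proof below. -/
theorem hochschildD0_matQuot (m : MatQuot A) :
    hochschildD0 k A (MatQuot A) m = -(matQuotToDer A m).1 := by
  obtain ⟨X, rfl⟩ := Submodule.Quotient.mk_surjective _ m
  ext a
  refine congrArg (Submodule.Quotient.mk (p := Subalgebra.toSubmodule A))
    (?_ : (a : Matrix (Fin n) (Fin n) k) * X - X * a = -(X * a - a * X))
  rw [neg_sub]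

theorem exact_matQuotToDer_derivationsToH1 :
    Function.Exact (matQuotToDer A) (derivationsToH1 k A (MatQuot A)) := by
  intro f
  rw [derivationsToH1_eq_zero_iff]
  constructor
  · rintro ⟨m, hm⟩
    refine ⟨-m, Subtype.ext ?_⟩
    rw [← hm, hochschildD0_matQuot, map_neg]
    rfl
  · rintro ⟨m, rfl⟩
    refine ⟨-m, ?_⟩
    rw [hochschildD0_matQuot, map_neg]
    exact neg_neg _

/-! ### The dimension count -/

/-- A quotient of the derivations, which form a subspace of the finite-dimensional space of linear
maps from `A` to `M_n(k)/A`. -/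
instance finite_hochschildH1 : Module.Finite k (HochschildH1 k A (MatQuot A)) :=
  Module.Finite.of_surjective _ (derivationsToH1_surjective k A (MatQuot A))

theorem toSubmodule_le_matNormalizer : Subalgebra.toSubmodule A ≤ matNormalizer A := fun _ hX =>
  (matToDer_eq_zero_iff A _).1 (toSubmodule_le_ker_matToDer A hX)

theorem finrank_normalizerQuot_add :
    Module.finrank k (NormalizerQuot A) + Module.finrank k (Subalgebra.toSubmodule A) =
      Module.finrank k (matNormalizer A) := by
  rw [← Submodule.finrank_quotient_add_finrank
    ((Subalgebra.toSubmodule A).submoduleOf (matNormalizer A)),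
    (Submodule.submoduleOfEquivOfLe (toSubmodule_le_matNormalizer A)).finrank_eq]

/-- Rank-nullity for `g` and for `h`, with exactness identifying each kernel with the preceding
range. The additive form avoids subtraction of natural numbers. -/
theorem finrank_add_eq_of_exact {V₁ V₂ V₃ V₄ : Type*} [AddCommGroup V₁] [Module k V₁]
    [AddCommGroup V₂] [Module k V₂] [AddCommGroup V₃] [Module k V₃] [AddCommGroup V₄] [Module k V₄]
    [FiniteDimensional k V₂] [FiniteDimensional k V₃] {f : V₁ →ₗ[k] V₂} {g : V₂ →ₗ[k] V₃}
    {h : V₃ →ₗ[k] V₄} (hf : Function.Injective f) (hfg : Function.Exact f g)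
    (hgh : Function.Exact g h) (hh : Function.Surjective h) :
    Module.finrank k V₁ + Module.finrank k V₃ = Module.finrank k V₂ + Module.finrank k V₄ := by
  have h1 := h.finrank_range_add_finrank_ker
  have h2 := g.finrank_range_add_finrank_ker
  rw [LinearMap.range_eq_top.2 hh, finrank_top, hgh.linearMap_ker_eq] at h1
  rw [hfg.linearMap_ker_eq, LinearMap.finrank_range_of_inj hf] at h2
  lia

/-- The spaces `N(A)/A` and `M_n(k)/A` are both smaller by `dim A` than `N(A)` and `M_n(k)`. They
stand on opposite sides of the dimension identity of the sequence, so `dim A` cancels. -/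
theorem finrank_derivations_add :
    Module.finrank k (derivations k A (MatQuot A)) + Module.finrank k (matNormalizer A) =
      Module.finrank k (HochschildH1 k A (MatQuot A)) + n ^ 2 := by
  have h1 : Module.finrank k (NormalizerQuot A) + Module.finrank k (derivations k A (MatQuot A)) =
      Module.finrank k (MatQuot A) + Module.finrank k (HochschildH1 k A (MatQuot A)) :=
    finrank_add_eq_of_exact (V₁ := NormalizerQuot A) (V₂ := MatQuot A)
      (V₃ := derivations k A (MatQuot A)) (V₄ := HochschildH1 k A (MatQuot A))
      (f := normalizerQuotToMatQuot A) (g := matQuotToDer A)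
      (h := derivationsToH1 k A (MatQuot A)) (normalizerQuotToMatQuot_injective A)
      (exact_normalizerQuotToMatQuot_matQuotToDer A) (exact_matQuotToDer_derivationsToH1 A)
      (derivationsToH1_surjective k A (MatQuot A))
  have h2 := finrank_normalizerQuot_add A
  have h3 : Module.finrank k (MatQuot A) + Module.finrank k (Subalgebra.toSubmodule A) = n ^ 2 := by
    rw [Submodule.finrank_quotient_add_finrank, Module.finrank_matrix, Fintype.card_fin,
      Module.finrank_self, mul_one, sq]
  rw [← h2, ← h3, ← add_assoc, ← add_assoc, add_comm (Module.finrank k (derivations _ _ _)), h1,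
    add_comm (Module.finrank k (MatQuot A))]

end ExactSequence

/-! ### Normal forms over affine schemes and the universal property -/

noncomputable section NormalFormSpec

variable {X : Scheme.{0}} {n d : ℕ} {c : Fin d → Fin n × Fin n}

/-- The global functions on `Spec R` given by the entries of matrices over `R`. -/
def specFrame (R : CommRingCat.{0}) (f : Fin d → Matrix (Fin n) (Fin n) R) (k : Fin d) :
    Matrix (Fin n) (Fin n) Γ(Spec R, ⊤) :=
  (Scheme.ΓSpecIso R).inv.hom.mapMatrix (f k)

theorem specFrame_injective (R : CommRingCat.{0}) :
    Function.Injective (specFrame (n := n) (d := d) R) := by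
  intro f f' h
  ext k i j
  exact (ConcreteCategory.bijective_of_isIso (Scheme.ΓSpecIso R).inv).1
    (congrFun (congrFun (congrFun h k) i) j)

/-- Naturality of `Scheme.ΓSpecIso` turns pullback along a morphism of spectra into entrywise
application of the ring homomorphism. -/
theorem MatSubalgebraSheaf.IsNF.pullback_specMap {R S : CommRingCat.{0}} (φ : R ⟶ S)
    {A : MatSubalgebraSheaf n (Spec R)} {f : Fin d → Matrix (Fin n) (Fin n) R}
    (h : A.IsNF c ⊤ (specFrame R f)) :
    (A.pullback (Spec.map φ)).IsNF c ⊤ (specFrame S fun k => φ.hom.mapMatrix (f k)) := by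
  have e : (specFrame S fun k => φ.hom.mapMatrix (f k)) =
      fun k => ((Spec.map φ).app ⊤).hom.mapMatrix (specFrame R f k) := by
    funext k
    ext i j
    exact congrArg (fun g => g.hom (f k i j)) (Scheme.ΓSpecIso_inv_naturality φ)
  rw [e]
  exact h.pullback (Spec.map φ)

/-- The image of `Spec O_{X,x}` consists of the generizations of `x`, and these lie in every open
neighbourhood of `x`. -/
theorem fromSpecStalk_preimage {x : X} {V : X.Opens} (hx : x ∈ V) :
    X.fromSpecStalk x ⁻¹ᵁ V = ⊤ := by
  rw [eq_top_iff]
  intro y _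
  have h : X.fromSpecStalk x y ∈ Set.range (X.fromSpecStalk x) := ⟨y, rfl⟩
  rw [Scheme.range_fromSpecStalk] at h
  exact h.mem_open V.isOpen hx

theorem MatSubalgebraSheaf.IsNF.pullback_fromSpecStalk {A : MatSubalgebraSheaf n X} {V : X.Opens}
    {f : Fin d → Matrix (Fin n) (Fin n) Γ(X, V)} (h : A.IsNF c V f) {x : X} (hx : x ∈ V) :
    (A.pullback (X.fromSpecStalk x)).IsNF c ⊤
      (specFrame (X.presheaf.stalk x) fun k => matGerm V x hx (f k)) := by
  -- The pulled back frame lives on the preimage of `V`, which is the whole spectrum but not by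
  -- definition. After restriction along this equality, a section of `X` on `V` becomes its germ at
  -- `x`, seen as a global function.
  have h1 : (X.fromSpecStalk x).app V ≫ (Spec (X.presheaf.stalk x)).presheaf.map
      (homOfLE (fromSpecStalk_preimage hx).ge).op =
        X.presheaf.germ V x hx ≫ (Scheme.ΓSpecIso (X.presheaf.stalk x)).inv := by
    rw [Scheme.fromSpecStalk_app hx, Category.assoc, Category.assoc, ← Functor.map_comp]
    have h2 := (Spec (X.presheaf.stalk x)).presheaf.map_id (op ⊤)
    exact congrArg _ ((congrArg _ h2).trans (Category.comp_id _))
  have e : (specFrame (X.presheaf.stalk x) fun k => matGerm V x hx (f k)) =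
      fun k => matRes (fromSpecStalk_preimage hx).ge
        (((X.fromSpecStalk x).app V).hom.mapMatrix (f k)) := by
    funext k
    ext i j
    exact congrArg (fun g => g.hom (f k i j)) h1.symm
  rw [e]
  exact (h.pullback (X.fromSpecStalk x)).res (fromSpecStalk_preimage hx).ge

/-- The normal form at a morphism from the spectrum of a ring that factors through
the spectrum of a local ring. -/
theorem MatSubalgebraSheaf.IsNF.pullback_specMap_fromSpecStalk {A : MatSubalgebraSheaf n X}
    {V : X.Opens} {f : Fin d → Matrix (Fin n) (Fin n) Γ(X, V)} (h : A.IsNF c V f) {x : X}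
    (hx : x ∈ V) {R : CommRingCat.{0}} (φ : X.presheaf.stalk x ⟶ R) :
    (A.pullback (Spec.map φ ≫ X.fromSpecStalk x)).IsNF c ⊤
      (specFrame R fun k => φ.hom.mapMatrix (matGerm V x hx (f k))) := by
  rw [MatSubalgebraSheaf.pullback_comp]
  exact (h.pullback_fromSpecStalk hx).pullback_specMap φ

/-- The mold on `Spec R` of a subalgebra in normal form. -/
def Mold.ofSpecNF {R : CommRingCat.{0}} {f : Fin d → Matrix (Fin n) (Fin n) R} (h : NFRel c f) :
    Mold n d (Spec R) :=
  Mold.ofNF (h.map (Scheme.ΓSpecIso R).inv.hom)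

theorem Mold.ofSpecNF_isNF {R : CommRingCat.{0}} {f : Fin d → Matrix (Fin n) (Fin n) R}
    (h : NFRel c f) : (Mold.ofSpecNF h).IsNF c ⊤ (specFrame R f) :=
  MatSubalgebraSheaf.ofNF_isNF (h.map (Scheme.ΓSpecIso R).inv.hom)

/-- Under the representing bijection, a morphism corresponds to the pullback of the universal
element. -/
theorem universalMold_pullback_bijective (n d : ℕ) :
    Function.Bijective fun g : X ⟶ MoldScheme n d => (universalMold n d).pullback g := by
  have h := ((moldFunctor n d).representableBy.homEquiv (X := X)).bijective
  have e : (fun g : X ⟶ MoldScheme n d => (universalMold n d).pullback g) =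
      (moldFunctor n d).representableBy.homEquiv (X := X) :=
    funext fun g => ((moldFunctor n d).representableBy.homEquiv_eq g).symm
  rw [e]
  exact h

/-- A global normal form determines the mold, so morphisms to the moduli scheme can be compared
through matrices. -/
theorem hom_moldScheme_ext {g h : X ⟶ MoldScheme n d} {f : Fin d → Matrix (Fin n) (Fin n) Γ(X, ⊤)}
    (hg : ((universalMold n d).pullback g).IsNF c ⊤ f)
    (hh : ((universalMold n d).pullback h).IsNF c ⊤ f) : g = h :=
  (universalMold_pullback_bijective n d).1 (Mold.ext' (MatSubalgebraSheaf.eq_of_isNF hg hh))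

end NormalFormSpec

/-! ### From point derivations to derivations of the fibre -/

noncomputable section FrameDerivations

variable {n d : ℕ} {S K : Type*} [CommRing S] [Field K] {r : S →+* K}

/-- A point derivation applied to the entries of a matrix. -/
def matDeriv (D : pointDerivations r) (M : Matrix (Fin n) (Fin n) S) : Matrix (Fin n) (Fin n) K :=
  M.map D.1

theorem pointDerivations_sum (D : pointDerivations r) {ι : Type*} (I : Finset ι) (u : ι → S) :
    D.1 (∑ i ∈ I, u i) = ∑ i ∈ I, D.1 (u i) :=
  map_sum (AddMonoidHom.mk' D.1 D.2.1) u I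

theorem pointDerivations_zero (D : pointDerivations r) : D.1 0 = 0 :=
  map_zero (AddMonoidHom.mk' D.1 D.2.1)

theorem pointDerivations_one (D : pointDerivations r) : D.1 1 = 0 := by
  simpa using D.2.2 1 1

theorem matDeriv_sum (D : pointDerivations r) {ι : Type*} (I : Finset ι)
    (u : ι → Matrix (Fin n) (Fin n) S) :
    matDeriv D (∑ i ∈ I, u i) = ∑ i ∈ I, matDeriv D (u i) := by
  ext i j
  simp [matDeriv, Matrix.sum_apply, pointDerivations_sum]

theorem matDeriv_smul (D : pointDerivations r) (a : S) (M : Matrix (Fin n) (Fin n) S) :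
    matDeriv D (a • M) = r a • matDeriv D M + D.1 a • r.mapMatrix M := by
  ext i j
  simp [matDeriv, D.2.2, mul_comm]

theorem matDeriv_mul (D : pointDerivations r) (M N : Matrix (Fin n) (Fin n) S) :
    matDeriv D (M * N) = r.mapMatrix M * matDeriv D N + matDeriv D M * r.mapMatrix N := by
  ext i j
  simp [matDeriv, Matrix.mul_apply, pointDerivations_sum, D.2.2, Finset.sum_add_distrib, mul_comm]

variable {c : Fin d → Fin n × Fin n} {F : Fin d → Matrix (Fin n) (Fin n) S}
  {A : Subalgebra K (Matrix (Fin n) (Fin n) K)}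

/-- The linear map `A → M_n(K)/A` that sends the frame `r(F k)` to the classes of `D(F k)`. -/
def frameDerivation (c : Fin d → Fin n × Fin n) (F : Fin d → Matrix (Fin n) (Fin n) S)
    (A : Subalgebra K (Matrix (Fin n) (Fin n) K)) (D : pointDerivations r) : A →ₗ[K] MatQuot A where
  toFun a := Submodule.Quotient.mk (∑ k, a.1 (c k).1 (c k).2 • matDeriv D (F k))
  map_add' a b := by
    rw [← Submodule.Quotient.mk_add, ← Finset.sum_add_distrib]
    simp [add_smul]
  map_smul' t a := by
    rw [RingHom.id_apply, ← Submodule.Quotient.mk_smul, Finset.smul_sum]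
    simp [mul_smul]

/-- Expand `s = ∑ s_{c k} F k` by the product rule. The terms in which `D` hits a coefficient are
multiples of the `r(F k)`, hence lie in `A`; the others are the defining sum. So any lift of `a` in
the span of the frame may be used, not only the frame itself. -/
theorem frameDerivation_eq (hA : ∀ m, m ∈ A ↔ NFMem c (fun k => r.mapMatrix (F k)) m)
    (hF : NFDelta c F) (D : pointDerivations r) (a : A) {s : Matrix (Fin n) (Fin n) S}
    (hs : NFMem c F s) (ha : a.1 = r.mapMatrix s) :
    frameDerivation c F A D a = Submodule.Quotient.mk (matDeriv D s) := by
  refine ((Submodule.Quotient.eq (Subalgebra.toSubmodule A)).2 ?_).symm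
  have h1 : matDeriv D s - ∑ k, a.1 (c k).1 (c k).2 • matDeriv D (F k) =
      ∑ k, D.1 (s (c k).1 (c k).2) • r.mapMatrix (F k) := by
    have hs' : matDeriv D s = matDeriv D (∑ k, s (c k).1 (c k).2 • F k) := congrArg _ hs
    rw [hs', matDeriv_sum, ha, sub_eq_iff_eq_add', ← Finset.sum_add_distrib]
    exact Finset.sum_congr rfl fun k _ => matDeriv_smul D _ _
  rw [h1]
  exact (hA _).2 (NFMem.sum (hF.map r) _)

theorem exists_lift_nfMem (hA : ∀ m, m ∈ A ↔ NFMem c (fun k => r.mapMatrix (F k)) m)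
    (hr : Function.Surjective r) (hF : NFDelta c F) (a : A) :
    ∃ s, NFMem c F s ∧ a.1 = r.mapMatrix s := by
  choose t ht using fun k => hr (a.1 (c k).1 (c k).2)
  refine ⟨∑ k, t k • F k, NFMem.sum hF t, ((hA _).1 a.2).trans ?_⟩
  rw [map_sum]
  exact Finset.sum_congr rfl fun k _ => by rw [mapMatrix_smul, ht]

theorem frameDerivation_mem (hA : ∀ m, m ∈ A ↔ NFMem c (fun k => r.mapMatrix (F k)) m)
    (hr : Function.Surjective r) (hF : NFRel c F) (D : pointDerivations r) :
    frameDerivation c F A D ∈ derivations K A (MatQuot A) := by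
  intro a b
  obtain ⟨s, hs, has⟩ := exists_lift_nfMem hA hr hF.delta a
  obtain ⟨t, ht, hbt⟩ := exists_lift_nfMem hA hr hF.delta b
  -- The span of the frame is closed under multiplication, so the product of the lifts is an
  -- admissible lift of `a * b`, and the product rule for matrices descends to classes.
  have hst : NFMem c F (s * t) := (nfSubalgebra hF).mul_mem hs ht
  rw [frameDerivation_eq hA hF.delta D a hs has, frameDerivation_eq hA hF.delta D b ht hbt,
    frameDerivation_eq hA hF.delta D (a * b) hst (by rw [map_mul, ← has, ← hbt]; rfl),
    matDeriv_mul, ← has, ← hbt]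
  rfl

/-- The map from point derivations to the derivations `A → M_n(K)/A`. -/
def pointDerivationsToDer (hA : ∀ m, m ∈ A ↔ NFMem c (fun k => r.mapMatrix (F k)) m)
    (hr : Function.Surjective r) (hF : NFRel c F) :
    pointDerivations r →ₗ[K] derivations K A (MatQuot A) where
  toFun D := ⟨frameDerivation c F A D, frameDerivation_mem hA hr hF D⟩
  map_add' D E := by
    refine Subtype.ext (LinearMap.ext fun a => ?_)
    refine congrArg (Submodule.Quotient.mk (p := Subalgebra.toSubmodule A))
      (?_ : ∑ k, a.1 (c k).1 (c k).2 • matDeriv (D + E) (F k) =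
        ∑ k, a.1 (c k).1 (c k).2 • matDeriv D (F k) + ∑ k, a.1 (c k).1 (c k).2 • matDeriv E (F k))
    rw [← Finset.sum_add_distrib]
    exact Finset.sum_congr rfl fun k _ => smul_add _ _ _
  map_smul' t D := by
    refine Subtype.ext (LinearMap.ext fun a => ?_)
    refine congrArg (Submodule.Quotient.mk (p := Subalgebra.toSubmodule A))
      (?_ : ∑ k, a.1 (c k).1 (c k).2 • matDeriv (t • D) (F k) =
        t • ∑ k, a.1 (c k).1 (c k).2 • matDeriv D (F k))
    rw [Finset.smul_sum]
    exact Finset.sum_congr rfl fun k _ => smul_comm _ t _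

/-- The member `r(F k)` of the frame of `A`. -/
def frameElement (hA : ∀ m, m ∈ A ↔ NFMem c (fun k => r.mapMatrix (F k)) m)
    (hF : NFDelta c F) (k : Fin d) : A :=
  ⟨r.mapMatrix (F k), (hA _).2 ((hF.map r).mem k)⟩

theorem eq_sum_frameElement (hA : ∀ m, m ∈ A ↔ NFMem c (fun k => r.mapMatrix (F k)) m)
    (hF : NFDelta c F) (a : A) :
    a = ∑ k, a.1 (c k).1 (c k).2 • frameElement hA hF k := by
  apply Subtype.ext
  rw [AddSubmonoidClass.coe_finsetSum]
  exact (hA _).1 a.2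

theorem frameDerivation_frameElement (hA : ∀ m, m ∈ A ↔ NFMem c (fun k => r.mapMatrix (F k)) m)
    (hF : NFDelta c F) (D : pointDerivations r) (k : Fin d) :
    frameDerivation c F A D (frameElement hA hF k) =
      Submodule.Quotient.mk (matDeriv D (F k)) :=
  frameDerivation_eq hA hF D _ (hF.mem k) rfl

theorem linearMap_ext_frameElement (hA : ∀ m, m ∈ A ↔ NFMem c (fun k => r.mapMatrix (F k)) m)
    (hF : NFDelta c F) {M : Type*} [AddCommGroup M] [Module K M] {φ ψ : A →ₗ[K] M}
    (h : ∀ k, φ (frameElement hA hF k) = ψ (frameElement hA hF k)) : φ = ψ := by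
  ext a
  rw [eq_sum_frameElement hA hF a]
  simp only [map_sum, map_smul, h]

/-- The matrices that vanish at all positions `c k` meet the span of `f` only in zero. This makes
representatives modulo `A` that vanish there unique. -/
theorem NFMem.eq_zero {R : Type*} [CommRing R] {f : Fin d → Matrix (Fin n) (Fin n) R}
    {s : Matrix (Fin n) (Fin n) R} (h : NFMem c f s) (h0 : ∀ k, s (c k).1 (c k).2 = 0) : s = 0 := by
  have h' : s = ∑ k, s (c k).1 (c k).2 • f k := h
  rw [h']
  simp [h0]

/-- These entries of the frame are the constants 0 and 1, which every point derivation kills. -/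
theorem matDeriv_frame_entry (hF : NFDelta c F) (D : pointDerivations r) (k l : Fin d) :
    matDeriv D (F k) (c l).1 (c l).2 = 0 := by
  rw [matDeriv, Matrix.map_apply, hF k l]
  split_ifs
  · exact pointDerivations_one D
  · exact pointDerivations_zero D

/-- Vanishing of its class puts `D(F k)` into `A`, and its zeros at the normalized positions then
force it to vanish. -/
theorem matDeriv_eq_zero_of_frameDerivation (hA : ∀ m, m ∈ A ↔ NFMem c (fun k => r.mapMatrix (F k)) m)
    (hF : NFDelta c F) {D : pointDerivations r} (hD : frameDerivation c F A D = 0) (k : Fin d) :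
    matDeriv D (F k) = 0 := by
  have h1 := frameDerivation_frameElement hA hF D k
  rw [hD] at h1
  have h2 := (hA _).1 ((Submodule.Quotient.mk_eq_zero (Subalgebra.toSubmodule A)).1 h1.symm)
  exact h2.eq_zero (matDeriv_frame_entry hF D k)

/-! ### Deformations of a frame over the dual numbers -/

/-- The matrix `s + t ε` over the dual numbers. -/
def dualMatrix (s t : Matrix (Fin n) (Fin n) K) : Matrix (Fin n) (Fin n) (DualNumber K) :=
  Matrix.of fun i j => TrivSqZeroExt.inl (s i j) + TrivSqZeroExt.inr (t i j)

theorem dualMatrix_apply (s t : Matrix (Fin n) (Fin n) K) (i j : Fin n) :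
    dualMatrix s t i j = TrivSqZeroExt.inl (s i j) + TrivSqZeroExt.inr (t i j) :=
  rfl

theorem dualMatrix_mul (s t s' t' : Matrix (Fin n) (Fin n) K) :
    dualMatrix s t * dualMatrix s' t' = dualMatrix (s * s') (s * t' + t * s') := by
  ext i j
  · simp [dualMatrix, Matrix.mul_apply, TrivSqZeroExt.fst_sum]
  · simp [dualMatrix, Matrix.mul_apply, TrivSqZeroExt.snd_sum, Finset.sum_add_distrib, mul_comm]

theorem dualMatrix_one : dualMatrix 1 0 = (1 : Matrix (Fin n) (Fin n) (DualNumber K)) := by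
  ext i j
  · by_cases h : i = j <;> simp [dualMatrix, Matrix.one_apply, h]
  · by_cases h : i = j <;> simp [dualMatrix, Matrix.one_apply, h]

theorem mapMatrix_fstHom_dualMatrix (s t : Matrix (Fin n) (Fin n) K) :
    (TrivSqZeroExt.fstHom K K K).toRingHom.mapMatrix (dualMatrix s t) = s := by
  ext i j
  simp [dualMatrix]

theorem dualMatrix_inj {s t s' t' : Matrix (Fin n) (Fin n) K}
    (h : dualMatrix s t = dualMatrix s' t') : t = t' := by
  ext i j
  simpa [dualMatrix] using congrArg TrivSqZeroExt.snd (congrFun (congrFun h i) j)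

/-- The coefficient of `ε` in `∑ (s_{c k} + t_{c k} ε)(g k + e k ε)` is `∑ (t_{c k} g k + s_{c k} e
k)`. So membership splits into the normal form of `s` and a first-order condition on `t`. -/
theorem nfMem_dualMatrix {g e : Fin d → Matrix (Fin n) (Fin n) K}
    (he : ∀ k l, e k (c l).1 (c l).2 = 0) {s t : Matrix (Fin n) (Fin n) K} (hs : NFMem c g s)
    (ht : NFMem c g (t - ∑ k, s (c k).1 (c k).2 • e k)) :
    NFMem c (fun k => dualMatrix (g k) (e k)) (dualMatrix s t) := by
  -- As the `e k` vanish at the positions `c l`, the correction leaves the coordinates of `t`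
  -- unchanged.
  have h0 (l) : (t - ∑ k, s (c k).1 (c k).2 • e k) (c l).1 (c l).2 = t (c l).1 (c l).2 := by
    simp [Matrix.sum_apply, he]
  have ht' : t - ∑ k, s (c k).1 (c k).2 • e k = ∑ k, t (c k).1 (c k).2 • g k := by
    refine Eq.trans ht ?_
    simp only [h0]
  have hs' : s = ∑ k, s (c k).1 (c k).2 • g k := hs
  change dualMatrix s t =
    ∑ k, dualMatrix s t (c k).1 (c k).2 • dualMatrix (g k) (e k)
  ext i j
  · have h1 := congrFun (congrFun hs' i) j
    simpa [dualMatrix, Matrix.sum_apply, TrivSqZeroExt.fst_sum] using h1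
  · have h1 : t i j = ∑ k, (t (c k).1 (c k).2 * g k i j + s (c k).1 (c k).2 * e k i j) := by
      have h2 := Matrix.ext_iff.2 (sub_eq_iff_eq_add.1 ht') i j
      rw [h2, Matrix.add_apply, Matrix.sum_apply, Matrix.sum_apply, Finset.sum_add_distrib]
      rfl
    rw [Matrix.sum_apply, TrivSqZeroExt.snd_sum]
    simp only [Matrix.smul_apply, dualMatrix_apply, smul_eq_mul, TrivSqZeroExt.snd_mul,
      TrivSqZeroExt.snd_add, TrivSqZeroExt.fst_add,
      TrivSqZeroExt.fst_inl, TrivSqZeroExt.snd_inl, TrivSqZeroExt.fst_inr, TrivSqZeroExt.snd_inr,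
      zero_add, add_zero, MulOpposite.smul_eq_mul_unop, MulOpposite.unop_op, h1]
    exact Finset.sum_congr rfl fun k _ => add_comm _ _

/-- A derivation `A → M_n(K)/A` gives a deformation of the frame of `A` over the dual numbers. -/
theorem exists_dual_frame (hA : ∀ m, m ∈ A ↔ NFMem c (fun k => r.mapMatrix (F k)) m)
    (hF : NFDelta c F) {δ : A →ₗ[K] MatQuot A} (hδ : δ ∈ derivations K A (MatQuot A)) :
    ∃ e : Fin d → Matrix (Fin n) (Fin n) K,
      (∀ k, δ (frameElement hA hF k) = Submodule.Quotient.mk (e k)) ∧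
      NFRel c (fun k => dualMatrix (r.mapMatrix (F k)) (e k)) := by
  let g : Fin d → Matrix (Fin n) (Fin n) K := fun k => r.mapMatrix (F k)
  have hg : NFDelta c g := hF.map r
  choose e₀ he₀ using fun k => Submodule.Quotient.mk_surjective _ (δ (frameElement hA hF k))
  -- Subtracting an element of `A` keeps the class and clears the entries at the positions `c l`,
  -- which preserves the normalization of the deformed frame.
  let e : Fin d → Matrix (Fin n) (Fin n) K := fun k =>
    e₀ k - ∑ l, e₀ k (c l).1 (c l).2 • g l
  have he (k l) : e k (c l).1 (c l).2 = 0 := by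
    simp [e, Matrix.sum_apply, hg _ l]
  have hδe (k) : δ (frameElement hA hF k) = Submodule.Quotient.mk (e k) := by
    rw [← he₀]
    refine (Submodule.Quotient.eq (Subalgebra.toSubmodule A)).2 ?_
    rw [sub_sub_cancel]
    exact (hA _).2 (NFMem.sum hg _)
  have hδa (a : A) : δ a = Submodule.Quotient.mk (∑ k, a.1 (c k).1 (c k).2 • e k) := by
    conv_lhs => rw [eq_sum_frameElement hA hF a]
    rw [map_sum, ← Submodule.mkQ_apply, map_sum]
    refine Finset.sum_congr rfl fun k _ => ?_
    rw [map_smul, map_smul, hδe]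
    rfl
  -- If `t` represents `δ(s)`, then `s + t ε` lies in the deformed span. Both the unit and the
  -- products of the frame are handled by this criterion.
  have hmem {s t : Matrix (Fin n) (Fin n) K} (hs : s ∈ A)
      (ht : δ ⟨s, hs⟩ = Submodule.Quotient.mk t) :
      NFMem c (fun k => dualMatrix (g k) (e k)) (dualMatrix s t) := by
    refine nfMem_dualMatrix he ((hA s).1 hs) ((hA _).1 ?_)
    rw [hδa] at ht
    exact (Submodule.Quotient.eq (Subalgebra.toSubmodule A)).1 ht.symm
  refine ⟨e, hδe, ?_, ?_, fun k l => ?_⟩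
  · intro k l
    have h1 := hg k l
    simp only [g] at h1
    simp only [dualMatrix, Matrix.of_apply, he, h1]
    split_ifs <;> simp
  · rw [← dualMatrix_one]
    refine hmem A.one_mem ?_
    -- The Leibniz rule for `1 = 1 * 1`.
    have h1 : δ 1 = 0 := by simpa using hδ 1 1
    exact h1
  · rw [dualMatrix_mul]
    refine hmem (A.mul_mem (frameElement hA hF k).2 (frameElement hA hF l).2) ?_
    -- The coefficient of `ε` in the product of two deformed frame members is the Leibniz
    -- expression, so it represents `δ` of the product.
    refine (hδ (frameElement hA hF k) (frameElement hA hF l)).trans ?_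
    rw [hδe, hδe]
    rfl

end FrameDerivations

/-! ### The tangent space of the moduli scheme -/

noncomputable section TangentSpace

variable {n d : ℕ} {x : MoldScheme n d} {c : Fin d → Fin n × Fin n} {V : (MoldScheme n d).Opens}
  {f : Fin d → Matrix (Fin n) (Fin n) Γ(MoldScheme n d, V)}

theorem mem_fiber_iff {X : Scheme.{0}} {A : Mold n d X} {x : X} {V : X.Opens}
    {f : Fin d → Matrix (Fin n) (Fin n) Γ(X, V)} (hx : x ∈ V) (hf : A.IsNF c V f)
    (m : Matrix (Fin n) (Fin n) (X.residueField x)) :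
    m ∈ A.fiber x ↔ NFMem c (fun k => (X.residue x).hom.mapMatrix (matGerm V x hx (f k))) m :=
  mem_matExtend_iff_nfMem (X.residue x).hom (hf.delta.map (X.presheaf.germ V x hx).hom)
    (fun s => hf.mem_stalk_iff hx s) m

/-- The normal form at a tangent vector. -/
theorem isNF_pullback_derivationTangentVector (hx : x ∈ V) (hf : (universalMold n d).IsNF c V f)
    (D : pointDerivations ((MoldScheme n d).residue x).hom) :
    ((universalMold n d).pullback (derivationTangentVector D).hom).IsNF c ⊤
      (specFrame (.of (DualNumber ((MoldScheme n d).residueField x))) fun k =>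
        dualMatrix (((MoldScheme n d).residue x).hom.mapMatrix (matGerm V x hx (f k)))
          (matDeriv D (matGerm V x hx (f k)))) :=
  hf.pullback_specMap_fromSpecStalk hx (CommRingCat.ofHom (derivationHom _ D))

theorem NFRel.of_isNF {X : Scheme.{0}} {A : MatSubalgebraSheaf n X} {x : X} {V : X.Opens}
    {f : Fin d → Matrix (Fin n) (Fin n) Γ(X, V)} (hx : x ∈ V) (hf : A.IsNF c V f) :
    NFRel c fun k => matGerm V x hx (f k) :=
  hf.rel.map (X.presheaf.germ V x hx).hom

/-- A deformation of the frame of the fibre over the dual numbers comes from a tangent vector. -/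
theorem exists_matDeriv_eq (hx : x ∈ V) (hf : (universalMold n d).IsNF c V f)
    {e : Fin d → Matrix (Fin n) (Fin n) ((MoldScheme n d).residueField x)}
    (he : NFRel c fun k =>
      dualMatrix (((MoldScheme n d).residue x).hom.mapMatrix (matGerm V x hx (f k))) (e k)) :
    ∃ D : pointDerivations ((MoldScheme n d).residue x).hom,
      ∀ k, matDeriv D (matGerm V x hx (f k)) = e k := by
  let R : CommRingCat.{0} := .of (DualNumber ((MoldScheme n d).residueField x))
  have hB := Mold.ofSpecNF_isNF (R := R) he
  -- The deformed frame defines a mold on the spectrum of the dual numbers, hence a morphism `v` to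
  -- the moduli scheme.
  obtain ⟨v, hv⟩ := (universalMold_pullback_bijective n d).2 (Mold.ofSpecNF (R := R) he)
  have hv' : (universalMold n d).pullback v = Mold.ofSpecNF (R := R) he := hv
  rw [← hv'] at hB
  -- Setting `ε = 0` in the deformed frame returns the frame of the fibre, which is also the normal
  -- form along the canonical morphism from `Spec k(x)`. So `v` is a tangent vector at `x`.
  have hres : Spec.map (CommRingCat.ofHom (TrivSqZeroExt.fstHom ((MoldScheme n d).residueField x)
      ((MoldScheme n d).residueField x) ((MoldScheme n d).residueField x)).toRingHom) ≫ v =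
      (MoldScheme n d).fromSpecResidueField x := by
    refine hom_moldScheme_ext (c := c)
      (f := specFrame ((MoldScheme n d).residueField x) fun k =>
        ((MoldScheme n d).residue x).hom.mapMatrix (matGerm V x hx (f k))) ?_
      (hf.pullback_specMap_fromSpecStalk hx ((MoldScheme n d).residue x))
    rw [Mold.pullback_comp]
    have h1 := hB.pullback_specMap (CommRingCat.ofHom (TrivSqZeroExt.fstHom
      ((MoldScheme n d).residueField x) ((MoldScheme n d).residueField x)
      ((MoldScheme n d).residueField x)).toRingHom)
    have h2 (k) := mapMatrix_fstHom_dualMatrix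
      (((MoldScheme n d).residue x).hom.mapMatrix (matGerm V x hx (f k))) (e k)
    simp only [CommRingCat.hom_ofHom, h2] at h1
    exact h1
  obtain ⟨D, hD⟩ := derivationTangentVector_bijective.2 (⟨v, hres⟩ : TangentVector _ x)
  have h1 := isNF_pullback_derivationTangentVector hx hf D
  rw [hD] at h1
  -- The same mold has two normal forms in the chart `c`, one computed from `D` and one given by
  -- `e`. They agree by uniqueness, and the coefficients of `ε` give the claim.
  have h2 := specFrame_injective R (h1.unique hB)
  exact ⟨D, fun k => dualMatrix_inj (congrFun h2 k)⟩

/-- The mold pulled back along the tangent vector of `D` depends on `D` only through the derivatives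
of the frame. Hence `D` and 0 give the same mold and, by universality, the same tangent vector. -/
theorem pointDerivation_eq_zero (hx : x ∈ V) (hf : (universalMold n d).IsNF c V f)
    {D : pointDerivations ((MoldScheme n d).residue x).hom}
    (hD : ∀ k, matDeriv D (matGerm V x hx (f k)) = 0) : D = 0 := by
  refine derivationTangentVector_bijective.1 (TangentVector.ext ?_)
  have h1 := isNF_pullback_derivationTangentVector hx hf D
  have h2 := isNF_pullback_derivationTangentVector hx hf 0
  have h3 (k) : matDeriv (0 : pointDerivations ((MoldScheme n d).residue x).hom)
      (matGerm V x hx (f k)) = 0 := rfl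
  simp only [hD] at h1
  simp only [h3] at h2
  exact hom_moldScheme_ext h1 h2

theorem pointDerivationsToDer_bijective (hx : x ∈ V) (hf : (universalMold n d).IsNF c V f) :
    Function.Bijective (pointDerivationsToDer (mem_fiber_iff hx hf)
      (IsLocalRing.residue_surjective (R := (MoldScheme n d).presheaf.stalk x))
      (NFRel.of_isNF hx hf)) := by
  have hF := NFRel.of_isNF hx hf
  constructor
  · rw [injective_iff_map_eq_zero]
    intro D hD
    exact pointDerivation_eq_zero hx hf
      (matDeriv_eq_zero_of_frameDerivation (mem_fiber_iff hx hf) hF.delta (congrArg Subtype.val hD))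
  · intro δ
    obtain ⟨e, he, hrel⟩ := exists_dual_frame (mem_fiber_iff hx hf) hF.delta δ.2
    obtain ⟨D, hD⟩ := exists_matDeriv_eq hx hf hrel
    -- The frame spans the fibre, so the two derivations need only be compared on its members.
    refine ⟨D, Subtype.ext (linearMap_ext_frameElement (mem_fiber_iff hx hf) hF.delta fun k => ?_)⟩
    rw [he, ← hD]
    exact frameDerivation_frameElement (mem_fiber_iff hx hf) hF.delta D k

/-- The tangent space of the moduli scheme of molds at `x` is isomorphic to the space of derivations
of the fibre `A(x)` with values in `M_n(k(x))/A(x)`. -/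
theorem nonempty_tangentVector_linearEquiv (n d : ℕ) (x : MoldScheme n d) :
    Nonempty (TangentVector (MoldScheme n d) x ≃ₗ[(MoldScheme n d).residueField x]
      derivations ((MoldScheme n d).residueField x) ((universalMold n d).fiber x)
        (MatQuot ((universalMold n d).fiber x))) := by
  obtain ⟨c, V, f, hx, hf⟩ := (universalMold n d).exists_isNF x
  -- The vector space structure on tangent vectors was transported along `tangentVectorEquiv`, so
  -- this bijection is linear. The second factor is built from the chosen local frame.
  exact ⟨(tangentVectorEquiv.linearEquiv _).trans
    (LinearEquiv.ofBijective _ (pointDerivationsToDer_bijective hx hf))⟩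

end TangentSpace

theorem theorem1p1 :
    (∀ (k : Type*) [Field k] (n : ℕ) (A₀ : Subalgebra k (Matrix (Fin n) (Fin n) k)),
      Function.Injective (normalizerQuotToMatQuot A₀) ∧
      Function.Exact (normalizerQuotToMatQuot A₀) (matQuotToDer A₀) ∧
      Function.Exact (matQuotToDer A₀) (derivationsToH1 k A₀ (MatQuot A₀)) ∧
      Function.Surjective (derivationsToH1 k A₀ (MatQuot A₀))) ∧
    (∀ (n d : ℕ) (x : MoldScheme n d),
      let κ := (MoldScheme n d).residueField x
      let Ax : Subalgebra κ (Matrix (Fin n) (Fin n) κ) := (universalMold n d).fiber x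
      Module.Finite κ (TangentVector (MoldScheme n d) x) ∧
      Module.Finite κ (HochschildH1 κ Ax (MatQuot Ax)) ∧
      (Module.finrank κ (TangentVector (MoldScheme n d) x) : ℤ) =
        Module.finrank κ (HochschildH1 κ Ax (MatQuot Ax)) + (n : ℤ) ^ 2 -
          Module.finrank κ (matNormalizer Ax)) := by
  refine ⟨fun k _ n A₀ => ⟨normalizerQuotToMatQuot_injective A₀,
    exact_normalizerQuotToMatQuot_matQuotToDer A₀, exact_matQuotToDer_derivationsToH1 A₀,
    derivationsToH1_surjective k A₀ (MatQuot A₀)⟩, fun n d x => ?_⟩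
  intro κ Ax
  obtain ⟨e⟩ := nonempty_tangentVector_linearEquiv n d x
  refine ⟨Module.Finite.equiv e.symm, finite_hochschildH1 Ax, ?_⟩
  have h : Module.finrank κ (TangentVector (MoldScheme n d) x) +
      Module.finrank κ (matNormalizer Ax) =
      Module.finrank κ (HochschildH1 κ Ax (MatQuot Ax)) + n ^ 2 :=
    e.finrank_eq ▸ finrank_derivations_add Ax
  -- The difference is taken in the integers; moving the normalizer to the other side reduces the
  -- claim to the additive identity of natural numbers.
  rw [eq_sub_iff_add_eq]
  exact_mod_cast h
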